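/- **Setting.** A *projective decomposition* of a finite-dimensional Hilbert space is a finite set of nonzero, mutually orthogonal projectors that sum to the identity. For a unitary $U:A\otimes B\to C\otimes D$, a decomposition $\{P_A^i\}$ of $A$ *exerts no interference influence* on a decomposition $\{Q_D^j\}$ of $D$ if $[P_A^i\otimes I_B,\ U^\dagger(I_C\otimes Q_D^j)U]=0$ for all $i,j$. The decomposition $\{P_A^i\}$ is *preferred by $D$ given $U$* if (1) it exerts no interference influence on any decomposition of $D$; (2) every decomposition $\{R_A^k\}$ of $A$ with $[P_A^i,R_A^k]\neq 0$ for some $i,k$ exerts an interference influence on at least one decomposition of $D$; and (3) every decomposition of $A$ that satisfies (1) and (2) is contained in $\mathrm{span}\{P_A^i\}$. Let $\mathfrak C$ be a circuit without cycles, made up of finitely many unitary gates, whose wires carry nonzero finite-dimensional Hilbert spaces. Let the *bubble* $\mathfrak B=\{A_1,\dots,A_n\}$ be any finite set of wires of $\mathfrak C$, numbered so that for $m<k$ no upward path in the circuit leads from $A_k$ to $A_m$. Cut every wire $A_k\in\mathfrak B$. The broken circuit is a unitary $\mathcal U$ which has, besides the inputs and outputs of $\mathfrak C$, the segments $A_k^{\rm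 out}$ (coming out of the cuts) as inputs and the segments $A_k^{\rm in}$ (going into the cuts) as outputs. The *preferred set* $\mathfrak P(\mathfrak C,\mathfrak B)$ consists of, for each $k$, the decomposition $\{P_{A_k^{\rm out}}^{e_k'}\}$ of $A_k$ preferred by $\bigotimes_m A_m^{\rm in}$ given $\mathcal U$, and the decomposition $\{P_{A_k^{\rm in}}^{e_k}\}$ of $A_k$ preferred by $\bigotimes_m A_m^{\rm out}$ given $\mathcal U^\dagger$. Write $\tilde P=V^\dagger(P\otimes I)V$ for the Heisenberg representation of an operator $P$ on a wire of $\mathfrak C$, where $V$ is the unitary implemented by the part of $\mathfrak C$ before that wire, and let $d$ be the dimension of the total Hilbert space of $\mathfrak C$. **Theorem.** The preferred set $\mathfrak P(\mathfrak C,\mathfrak B)$ of $2n$ projective decompositions exists and is unique. For all choices of $P_{A_k^{\rm in}}^{e_k}$ and $P_{A_k^{\rm out}}^{e_k'}$ in its decompositions, $$\mathrm{Tr}\big(\tilde P_{A_n^{\rm out}}^{e_n'}\tilde P_{A_n^{\rm in}}^{e_n}\cdots\tilde P_{A_1^{\rm out}}^{e_1'}\tilde P_{A_1^{\rm in}}^{e_1}\,(I/d)\,\tilde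 P_{A_1^{\rm in}}^{e_1}\tilde P_{A_1^{\rm out}}^{e_1'}\cdots\tilde P_{A_n^{\rm in}}^{e_n}\tilde P_{A_n^{\rm out}}^{e_n'}\big)=\frac1d\,\mathrm{Tr}\big(\tilde P_{A_1^{\rm in}}^{e_1}\tilde P_{A_1^{\rm out}}^{e_1'}\cdots\tilde P_{A_n^{\rm in}}^{e_n}\tilde P_{A_n^{\rm out}}^{e_n'}\big).$$ Moreover $\mathfrak P(\mathfrak C,\mathfrak B)$ generates a consistent set of histories for $\rho=I/d$: the numbers on the left-hand side form a probability distribution over the histories $(e_1,e_1',\dots,e_n,e_n')$, and the expression on the left-hand side is linear in the projectors, in the sense that when some or all of the projectors in it are replaced by sums of projectors from the respective decompositions, its value is the sum of the probabilities of the histories so combined. -/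

import Mathlib

open Matrix Kronecker

noncomputable section

/-! ## Projective decompositions and preference -/

/-- A projective decomposition of `ℂ^n`: a finite set of nonzero, mutually orthogonal, orthogonal
projectors that sum to the identity. -/
@[ext]
structure ProjectiveDecomposition (n : Type*) [Fintype n] [DecidableEq n] where
  proj : Finset (Matrix n n ℂ)
  isStarProjection : ∀ P ∈ proj, IsStarProjection P
  ne_zero : ∀ P ∈ proj, P ≠ 0
  orthogonal : ∀ P ∈ proj, ∀ Q ∈ proj, P ≠ Q → P * Q = 0
  sum_eq_one : ∑ P ∈ proj, P = 1

section Preference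

variable {a b c d : Type*} [Fintype a] [DecidableEq a] [Fintype b] [DecidableEq b]
  [Fintype c] [DecidableEq c] [Fintype d] [DecidableEq d]

/-- For a unitary `U : A ⊗ B → C ⊗ D`, there is no interference influence from the decomposition
`P` on `A` to the decomposition `Q` on `D`: all the Heisenberg projectors `P^i ⊗ I_B` and
`U† (I_C ⊗ Q^j) U` commute. -/
def NoInterferenceInfluence (U : Matrix (c × d) (a × b) ℂ)
    (P : ProjectiveDecomposition a) (Q : ProjectiveDecomposition d) : Prop :=
  ∀ p ∈ P.proj, ∀ q ∈ Q.proj,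
    Commute (p ⊗ₖ (1 : Matrix b b ℂ)) (Uᴴ * ((1 : Matrix c c ℂ) ⊗ₖ q) * U)

/-- `P` exerts no interference influence on any decomposition on `D`. -/
def PrefCondOne (U : Matrix (c × d) (a × b) ℂ) (P : ProjectiveDecomposition a) : Prop :=
  ∀ Q : ProjectiveDecomposition d, NoInterferenceInfluence U P Q

/-- Every decomposition on `A` incompatible with `P` exerts an interference influence on at least
one decomposition on `D`. -/
def PrefCondTwo (U : Matrix (c × d) (a × b) ℂ) (P : ProjectiveDecomposition a) : Prop :=
  ∀ R : ProjectiveDecomposition a, (∃ p ∈ P.proj, ∃ r ∈ R.proj, ¬ Commute p r) →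
    ∃ Q : ProjectiveDecomposition d, ¬ NoInterferenceInfluence U R Q

/-- For a unitary `U : A ⊗ B → C ⊗ D`, the decomposition `P` on `A` is preferred by `D`. -/
def IsPreferredBy (U : Matrix (c × d) (a × b) ℂ) (P : ProjectiveDecomposition a) : Prop :=
  PrefCondOne U P ∧ PrefCondTwo U P ∧
    ∀ R : ProjectiveDecomposition a, PrefCondOne U R → PrefCondTwo U R →
      (R.proj : Set (Matrix a a ℂ)) ⊆ Submodule.span ℂ (P.proj : Set (Matrix a a ℂ))

end Preference

section Subsystems

variable {I J : Type*} [Fintype I] [DecidableEq I] [Fintype J] [DecidableEq J]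

/-- The operator `M ⊗ 1` on `⨂ i, ℂ^(x i)`, where `M` acts on the tensor factor `i`. -/
def onFactor (x : I → ℕ) (i : I) (M : Matrix (Fin (x i)) (Fin (x i)) ℂ) :
    Matrix (∀ j, Fin (x j)) (∀ j, Fin (x j)) ℂ :=
  (M ⊗ₖ (1 : Matrix (∀ j : {j // j ≠ i}, Fin (x j)) (∀ j : {j // j ≠ i}, Fin (x j)) ℂ)).submatrix
    (Equiv.piSplitAt i fun j => Fin (x j)) (Equiv.piSplitAt i fun j => Fin (x j))

/-- For a unitary `U` from the systems `I` to the systems `J`, the decomposition `P` on the input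
system `i` is preferred by the tensor product of the output systems `j` with `S j`. Here `U` is
regarded as a unitary `A ⊗ B → C ⊗ D` with `A` the system `i` and `D` the systems in `S`. -/
def IsPreferredBySystems (x : I → ℕ) (y : J → ℕ)
    (U : Matrix (∀ j, Fin (y j)) (∀ i, Fin (x i)) ℂ) (i : I) (S : J → Prop) [DecidablePred S]
    (P : ProjectiveDecomposition (Fin (x i))) : Prop :=
  IsPreferredBy
    (U.submatrix
      ((Equiv.piEquivPiSubtypeProd S fun j => Fin (y j)).trans (Equiv.prodComm _ _)).symm
      (Equiv.piSplitAt i fun j => Fin (x j)).symm) P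

end Subsystems

/-! ## Unitary circuits -/

/-- A finite-dimensional unitary circuit with set of wires (systems) `W`. The wire `w` carries the
Hilbert space `ℂ^(dim w)`; it comes out of the gate `source w` (out of the bottom of the circuit, if
this is `none`) and goes into the gate `target w` (into the top of the circuit, if this is `none`).
The circuit has no cycles, and its gates are listed in an order in which they can be
applied. Each gate is a unitary from the tensor product of the wires that go into it to the tensor
product of those that come out of it. -/
structure UnitaryCircuit (W : Type*) [Fintype W] [DecidableEq W] where
  numGates : ℕ
  dim : W → ℕ
  dim_pos : ∀ w, 0 < dim w
  source : W → Option (Fin numGates)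
  target : W → Option (Fin numGates)
  source_lt_target : ∀ w g h, source w = some g → target w = some h → g < h
  gate : ∀ g : Fin numGates,
    Matrix (∀ w : {w // source w = some g}, Fin (dim w))
      (∀ w : {w // target w = some g}, Fin (dim w)) ℂ
  gate_conjTranspose_mul : ∀ g, (gate g)ᴴ * gate g = 1
  gate_mul_conjTranspose : ∀ g, gate g * (gate g)ᴴ = 1

namespace UnitaryCircuit

variable {W : Type*} [Fintype W] [DecidableEq W] (C : UnitaryCircuit W)

/-- The wire `w` is present after the first `t` gates have been applied. -/
def Live (t : Fin (C.numGates + 1)) (w : W) : Prop :=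
  (∀ g, C.source w = some g → g.succ ≤ t) ∧ (∀ g, C.target w = some g → t ≤ g.castSucc)

instance (t : Fin (C.numGates + 1)) : DecidablePred (C.Live t) := fun w => by
  unfold Live; infer_instance

/-- The wires present after `t` gates. For `t = 0` these are the inputs of the circuit, for `t` the
number of gates its outputs. -/
abbrev Slice (t : Fin (C.numGates + 1)) : Type _ := {w : W // C.Live t w}

/-- The dimensions of the wires present after `t` gates. -/
abbrev sliceDim (t : Fin (C.numGates + 1)) (w : C.Slice t) : ℕ := C.dim w.1

/-- The labels of the product basis of the Hilbert space of the circuit after `t` gates. -/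
abbrev Basis (t : Fin (C.numGates + 1)) : Type _ := ∀ w : C.Slice t, Fin (C.sliceDim t w)

theorem live_of_source {g : Fin C.numGates} {w : W} (h : C.source w = some g) :
    C.Live g.succ w := by
  refine ⟨fun g' h' => ?_, fun g' h' => ?_⟩
  · rw [h] at h'; cases h'; exact le_rfl
  · exact Fin.succ_le_castSucc_iff.2 (C.source_lt_target w g g' h h')

theorem live_of_target {g : Fin C.numGates} {w : W} (h : C.target w = some g) :
    C.Live g.castSucc w := by
  refine ⟨fun g' h' => ?_, fun g' h' => ?_⟩
  · exact Fin.succ_le_castSucc_iff.2 (C.source_lt_target w g' g h' h)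
  · rw [h] at h'; cases h'; exact le_rfl

/-- The unitary that applies the gate `g` to its input wires and the identity to all other wires
present at that stage. -/
def step (g : Fin C.numGates) : Matrix (C.Basis g.succ) (C.Basis g.castSucc) ℂ :=
  Matrix.of fun x y =>
    if ∀ (w : W) (h : C.Live g.succ w) (h' : C.Live g.castSucc w), x ⟨w, h⟩ = y ⟨w, h'⟩ then
      C.gate g (fun w => x ⟨w.1, C.live_of_source w.2⟩) (fun w => y ⟨w.1, C.live_of_target w.2⟩)
    else 0

/-- The unitary implemented by the first `t` gates. -/
def evol (t : Fin (C.numGates + 1)) : Matrix (C.Basis t) (C.Basis 0) ℂ :=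
  Fin.induction (motive := fun t => Matrix (C.Basis t) (C.Basis 0) ℂ) 1
    (fun g V => C.step g * V) t

/-- The unitary implemented by the whole circuit. -/
def total : Matrix (C.Basis (Fin.last C.numGates)) (C.Basis 0) ℂ := C.evol (Fin.last C.numGates)

/-- The stage at which the wire `w` appears. -/
def birth (w : W) : Fin (C.numGates + 1) := (C.source w).elim 0 Fin.succ

theorem live_birth (w : W) : C.Live (C.birth w) w := by
  unfold birth
  rcases h : C.source w with _ | g
  · exact ⟨fun g hg => by simp [h] at hg, fun g _ => Fin.zero_le _⟩
  · exact C.live_of_source h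

/-- The Heisenberg representation `V† (M ⊗ I) V` of an operator `M` on the wire `w`, where `V` is the
part of the circuit that comes before `w`. -/
def heisenberg (w : W) (M : Matrix (Fin (C.dim w)) (Fin (C.dim w)) ℂ) :
    Matrix (C.Basis 0) (C.Basis 0) ℂ :=
  (C.evol (C.birth w))ᴴ * onFactor (C.sliceDim (C.birth w)) ⟨w, C.live_birth w⟩ M *
    C.evol (C.birth w)

/-- The dimension of the Hilbert space of the circuit. -/
def totalDim : ℕ := ∏ w : C.Slice 0, C.dim w.1

/-- The wire `w` is below the wire `w'`: an upward path through at least one gate leads from `w` to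
`w'`. -/
def Below : W → W → Prop :=
  Relation.TransGen fun w w' => ∃ g, C.target w = some g ∧ C.source w' = some g

/-! ## Incisions, bubbles, and the preferred set -/

/-- The wires of the circuit obtained by an incision in every wire in `B`. A wire `w` that is not in
`B` stays as `(w, false)`; a wire `w` in `B` is broken into the segment `(w, false)` that goes into
the incision and the segment `(w, true)` that comes out of it. -/
abbrev Segment (B : Finset W) : Type _ := {s : W × Bool // s.2 = true → s.1 ∈ B}

/-- The segment of `w` that goes into the target of `w`. -/
abbrev upper (B : Finset W) (w : W) : Segment B := ⟨(w, decide (w ∈ B)), fun h => by simpa using h⟩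

/-- The segment of `w` that comes out of the source of `w`. -/
abbrev lower (B : Finset W) (w : W) : Segment B := ⟨(w, false), fun h => by simp at h⟩

/-- The gate out of which a segment comes. -/
def cutSource (B : Finset W) (s : Segment B) : Option (Fin C.numGates) :=
  if s.1.2 = true then none else C.source s.1.1

/-- The gate into which a segment goes. -/
def cutTarget (B : Finset W) (s : Segment B) : Option (Fin C.numGates) :=
  if s.1.2 = false ∧ s.1.1 ∈ B then none else C.target s.1.1

theorem cutSource_lower (B : Finset W) (w : W) : C.cutSource B (lower B w) = C.source w := by
  simp [cutSource]

theorem cutTarget_upper (B : Finset W) (w : W) : C.cutTarget B (upper B w) = C.target w := by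
  by_cases h : w ∈ B <;> simp [cutTarget, h]

theorem eq_lower_of_cutSource {B : Finset W} {s : Segment B} {g : Fin C.numGates}
    (h : C.cutSource B s = some g) : s = lower B s.1.1 := by
  obtain ⟨⟨w, i⟩, hs⟩ := s
  cases i <;> simp_all [cutSource]

theorem eq_upper_of_cutTarget {B : Finset W} {s : Segment B} {g : Fin C.numGates}
    (h : C.cutTarget B s = some g) : s = upper B s.1.1 := by
  obtain ⟨⟨w, i⟩, hs⟩ := s
  by_cases hw : w ∈ B <;> cases i <;> simp_all [cutTarget]

/-- Basis labels of the outputs of a gate of the broken circuit, as labels of the outputs of the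
original gate. -/
def outEquiv (B : Finset W) (g : Fin C.numGates) :
    (∀ s : {s : Segment B // C.cutSource B s = some g}, Fin (C.dim s.1.1.1)) ≃
      (∀ w : {w // C.source w = some g}, Fin (C.dim w)) where
  toFun x w := x ⟨lower B w.1, by rw [cutSource_lower]; exact w.2⟩
  invFun x s := x ⟨s.1.1.1, by
    rw [← C.cutSource_lower B, ← C.eq_lower_of_cutSource s.2]; exact s.2⟩
  left_inv x := by
    funext ⟨s, hs⟩
    obtain ⟨w, rfl⟩ : ∃ w, s = lower B w := ⟨_, C.eq_lower_of_cutSource hs⟩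
    rfl
  right_inv x := rfl

/-- Basis labels of the inputs of a gate of the broken circuit, as labels of the inputs of the
original gate. -/
def inEquiv (B : Finset W) (g : Fin C.numGates) :
    (∀ s : {s : Segment B // C.cutTarget B s = some g}, Fin (C.dim s.1.1.1)) ≃
      (∀ w : {w // C.target w = some g}, Fin (C.dim w)) where
  toFun x w := x ⟨upper B w.1, by rw [cutTarget_upper]; exact w.2⟩
  invFun x s := x ⟨s.1.1.1, by
    rw [← C.cutTarget_upper B, ← C.eq_upper_of_cutTarget s.2]; exact s.2⟩
  left_inv x := by
    funext ⟨s, hs⟩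
    obtain ⟨w, rfl⟩ : ∃ w, s = upper B w := ⟨_, C.eq_upper_of_cutTarget hs⟩
    rfl
  right_inv x := rfl

/-- The broken circuit: an incision is made in every wire in `B`. The segments that go into the
incisions are pulled up to become outputs of the circuit, those that come out of the incisions are
pulled down to become inputs of the circuit, and the gates are unchanged. -/
def cut (B : Finset W) : UnitaryCircuit (Segment B) where
  numGates := C.numGates
  dim s := C.dim s.1.1
  dim_pos s := C.dim_pos s.1.1
  source := C.cutSource B
  target := C.cutTarget B
  source_lt_target s g h hg hh := by
    refine C.source_lt_target s.1.1 g h ?_ ?_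
    · rw [← C.cutSource_lower B, ← C.eq_lower_of_cutSource hg]; exact hg
    · rw [← C.cutTarget_upper B, ← C.eq_upper_of_cutTarget hh]; exact hh
  gate g := (C.gate g).submatrix (C.outEquiv B g) (C.inEquiv B g)
  gate_conjTranspose_mul g := by
    rw [conjTranspose_submatrix, submatrix_mul_equiv, C.gate_conjTranspose_mul, submatrix_one_equiv]
  gate_mul_conjTranspose g := by
    rw [conjTranspose_submatrix, submatrix_mul_equiv, C.gate_mul_conjTranspose, submatrix_one_equiv]

/-- `A^in`, for a wire `A` in the bubble: the output of the broken circuit that goes into the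
incision in `A`. -/
def cutIn (B : Finset W) (w : B) : (C.cut B).Slice (Fin.last C.numGates) :=
  ⟨lower B w.1, fun _ _ => Fin.le_last _, fun g hg => by
    have h : C.cutTarget B (lower B w.1) = some g := hg
    simp [cutTarget] at h⟩

/-- `A^out`, for a wire `A` in the bubble: the input of the broken circuit that comes out of the
incision in `A`. -/
def cutOut (B : Finset W) (w : B) : (C.cut B).Slice 0 :=
  ⟨⟨(w.1, true), fun _ => w.2⟩, fun g hg => by
    have h : C.cutSource B ⟨(w.1, true), fun _ => w.2⟩ = some g := hg
    simp [cutSource] at h, fun _ _ => Fin.zero_le _⟩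

/-- A choice of two projective decompositions for each wire in the bubble `B`. -/
@[ext]
structure BubbleDecompositions (B : Finset W) where
  ingoing : ∀ w : B, ProjectiveDecomposition (Fin (C.dim w))
  outgoing : ∀ w : B, ProjectiveDecomposition (Fin (C.dim w))

open Classical in
/-- `D` is the preferred set of projective decompositions for the bubble `B`. -/
def IsPreferredSet (B : Finset W) (D : C.BubbleDecompositions B) : Prop :=
  ∀ w : B,
    IsPreferredBySystems ((C.cut B).sliceDim 0) ((C.cut B).sliceDim (Fin.last C.numGates))
      (C.cut B).total (C.cutOut B w) (fun s => ∃ v : B, s = C.cutIn B v) (D.outgoing w) ∧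
    IsPreferredBySystems ((C.cut B).sliceDim (Fin.last C.numGates)) ((C.cut B).sliceDim 0)
      (C.cut B).totalᴴ (C.cutIn B w) (fun s => ∃ v : B, s = C.cutOut B v) (D.ingoing w)

end UnitaryCircuit

/-! ## Histories -/

/-- The sequence `a 0, b 0, a 1, b 1, …, a (n-1), b (n-1)`. -/
def interleave {α : Type*} {n : ℕ} (a b : Fin n → α) (j : Fin (n * 2)) : α :=
  if j.modNat = 0 then a j.divNat else b j.divNat

section Histories

variable {s : Type*} [Fintype s] [DecidableEq s] {N : ℕ}

/-- `Tr (X_N ⋯ X_1 ρ X_1 ⋯ X_N)`. -/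
def historyProb (ρ : Matrix s s ℂ) (X : Fin N → Matrix s s ℂ) : ℂ :=
  trace ((List.ofFn X).reverse.prod * ρ * (List.ofFn X).prod)

/-- The sets `D 1, …, D N` of Heisenberg projectors, in temporal order, generate a consistent
set of histories for the state `ρ`: the numbers `Tr (P_N ⋯ P_1 ρ P_1 ⋯ P_N)` for `P_k ∈ D k` form a
probability distribution, and this expression is linear in the projectors. That is, if some or all of
the projectors are replaced by sums of projectors from the respective `D k`, the result
is the sum of the probabilities of the histories so combined. -/
def IsConsistent (ρ : Matrix s s ℂ) (D : Fin N → Finset (Matrix s s ℂ)) : Prop :=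
  (∀ h ∈ Fintype.piFinset D, (historyProb ρ h).im = 0 ∧ 0 ≤ (historyProb ρ h).re) ∧
  ∑ h ∈ Fintype.piFinset D, historyProb ρ h = 1 ∧
  ∀ S : Fin N → Finset (Matrix s s ℂ), (∀ k, S k ⊆ D k) →
    historyProb ρ (fun k => ∑ P ∈ S k, P) = ∑ h ∈ Fintype.piFinset S, historyProb ρ h

end Histories

end

/-!
The preferred decomposition of `A` by `D` exists for every `U`: decompositions that satisfy the
first two conditions commute with each other, and their common refinements satisfy these conditions again,
so the decomposition with maximal span contains all others in its span
(`existsUnique_isPreferredBy`). It is unique because a decomposition is determined by its span.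

For the histories, only the first condition matters. It says that, in the broken circuit, an
ingoing preferred projector commutes with all operators on the segments that come out of the
incisions, and an outgoing one with all operators on the segments that go into them
(`IsPreferredSet.unaffected_ingoing`, `IsPreferredSet.unaffected_outgoing`). These relations descend
to the original circuit: if the wire `A_k` is not below `A_j`, an ingoing projector on `A_k`
commutes with every Heisenberg operator on `A_j`, and an outgoing projector on `A_j` with every one on `A_k`
(`IsPreferredSet.commute_ingoing`, `IsPreferredSet.commute_outgoing`). If the gates are listed
such that `A_k` appears before `A_j`, this holds because no influence passes from `A_k` to `A_j`
(`UnitaryCircuit.unaffected_of_not_below`). Otherwise an ingoing projector on `A_k` is pulled back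
through the gates in the original and in the broken circuit simultaneously. In the broken circuit it
stays trivial on all segments next to incisions, so rejoining the wires makes no difference and the
two operators keep corresponding matrix elements (`UnitaryCircuit.IsTransfer.pull`); hence the
operator in the original circuit is trivial on the wires of the bubble that it passes. Outgoing
projectors are pushed forward in the same way (`UnitaryCircuit.IsTransfer.push`).

Hence in the product `P̃_1 P̃'_1 ⋯ P̃_n P̃'_n` each ingoing projector can be moved to the left of
all outgoing projectors that precede it, which turns it into `E F`, with `E` the product of the ingoing
and `F` that of the outgoing projectors. All factors of `E` commute, and so do those of `F`, so `E`
and `F` are projectors and `Tr (F E E F) = Tr (E F)` (`historyProb_eq_trace`). The same holds for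
sums of projectors from the decompositions. Since the right-hand side is multilinear, this yields
linearity of the probabilities, and their sum is `Tr (I / d) = 1`
(`HistoryCommute.isConsistent`).
-/

/-! ### Projective decompositions and preference -/

namespace ProjectiveDecomposition

variable {n : Type*} [Fintype n] [DecidableEq n]

theorem mul_self (P : ProjectiveDecomposition n) {p : Matrix n n ℂ} (hp : p ∈ P.proj) :
    p * p = p := (P.isStarProjection p hp).isIdempotentElem

theorem mul_eq_ite (P : ProjectiveDecomposition n) {p q : Matrix n n ℂ} (hp : p ∈ P.proj)
    (hq : q ∈ P.proj) : p * q = if p = q then q else 0 := by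
  split_ifs with h
  · rw [h, P.mul_self hq]
  · exact P.orthogonal p hp q hq h

theorem commute (P : ProjectiveDecomposition n) {p q : Matrix n n ℂ} (hp : p ∈ P.proj)
    (hq : q ∈ P.proj) : Commute p q := by
  by_cases h : p = q
  · rw [h]
  · rw [Commute, SemiconjBy, P.orthogonal p hp q hq h, P.orthogonal q hq p hp (Ne.symm h)]

/-- An element of the span of a decomposition is a multiple of `q` after multiplication by one of
the projectors `q`. -/
theorem exists_smul_of_mem_span (P : ProjectiveDecomposition n) {x q : Matrix n n ℂ}
    (hx : x ∈ Submodule.span ℂ (P.proj : Set (Matrix n n ℂ))) (hq : q ∈ P.proj) :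
    ∃ c : ℂ, x * q = c • q ∧ q * x = c • q := by
  induction hx using Submodule.span_induction with
  | mem p hp =>
    refine ⟨if p = q then 1 else 0, ?_, ?_⟩
    · rw [P.mul_eq_ite hp hq]; split_ifs <;> simp
    · rw [(P.commute hq hp).eq, P.mul_eq_ite hp hq]; split_ifs <;> simp
  | zero => exact ⟨0, by simp, by simp⟩
  | add x y _ _ hx hy =>
    obtain ⟨c, h1, h2⟩ := hx
    obtain ⟨d, h3, h4⟩ := hy
    exact ⟨c + d, by rw [add_mul, h1, h3, add_smul], by rw [mul_add, h2, h4, add_smul]⟩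
  | smul a x _ hx =>
    obtain ⟨c, h1, h2⟩ := hx
    exact ⟨a * c, by rw [smul_mul_assoc, h1, smul_smul], by rw [mul_smul_comm, h2, smul_smul]⟩

theorem proj_subset_of_subset_span {P Q : ProjectiveDecomposition n}
    (h : (P.proj : Set (Matrix n n ℂ)) ⊆ Submodule.span ℂ (Q.proj : Set (Matrix n n ℂ)))
    (h' : (Q.proj : Set (Matrix n n ℂ)) ⊆ Submodule.span ℂ (P.proj : Set (Matrix n n ℂ))) :
    P.proj ⊆ Q.proj := by
  intro p hp
  have hsum : ∑ q ∈ Q.proj, p * q ≠ 0 := by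
    rw [← Finset.mul_sum, Q.sum_eq_one, mul_one]; exact P.ne_zero p hp
  obtain ⟨q, hq, hpq⟩ := Finset.exists_ne_zero_of_sum_ne_zero hsum
  obtain ⟨c, hc, -⟩ := Q.exists_smul_of_mem_span (h hp) hq
  obtain ⟨d, -, hd⟩ := P.exists_smul_of_mem_span (h' hq) hp
  have hc0 : c ≠ 0 := by rintro rfl; simp [hc] at hpq
  -- `c • q = p * q = d • p`, and two proportional nonzero idempotents are equal.
  have hq' : q = (c⁻¹ * d) • p := by
    rw [mul_smul, ← hd, hc, smul_smul, inv_mul_cancel₀ hc0, one_smul]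
  set e := c⁻¹ * d
  have hqq := Q.mul_self hq
  have he : (e * e - e) • p = 0 := by
    rw [hq', smul_mul_smul_comm, P.mul_self hp] at hqq
    rw [sub_smul, hqq, sub_self]
  have he2 : e * (e - 1) = 0 := by
    rcases smul_eq_zero.1 he with h | h
    · linear_combination h
    · exact absurd h (P.ne_zero p hp)
  rcases mul_eq_zero.1 he2 with h | h
  · exact absurd (by rw [hq', h, zero_smul]) (Q.ne_zero q hq)
  · rw [sub_eq_zero.1 h, one_smul] at hq'
    rwa [← hq']

/-- A decomposition is determined by the linear span of its projectors. -/
theorem eq_of_subset_span {P Q : ProjectiveDecomposition n}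
    (h : (P.proj : Set (Matrix n n ℂ)) ⊆ Submodule.span ℂ (Q.proj : Set (Matrix n n ℂ)))
    (h' : (Q.proj : Set (Matrix n n ℂ)) ⊆ Submodule.span ℂ (P.proj : Set (Matrix n n ℂ))) :
    P = Q :=
  ProjectiveDecomposition.ext <| Finset.Subset.antisymm (proj_subset_of_subset_span h h')
    (proj_subset_of_subset_span h' h)

/-- The decomposition with the single projector `1` (with none, if the space is zero). -/
noncomputable def trivial (n : Type*) [Fintype n] [DecidableEq n] : ProjectiveDecomposition n where
  proj := ({1} : Finset (Matrix n n ℂ)).erase 0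
  isStarProjection P hP := by
    rw [Finset.mem_erase, Finset.mem_singleton] at hP
    rw [hP.2]; exact .one _
  ne_zero P hP := (Finset.mem_erase.1 hP).1
  orthogonal P hP Q hQ h := by
    simp only [Finset.mem_erase, Finset.mem_singleton] at hP hQ
    exact absurd (hP.2.trans hQ.2.symm) h
  sum_eq_one := by rw [Finset.sum_erase (a := 0) (f := fun p => p) _ rfl, Finset.sum_singleton]

theorem eq_one_of_mem_trivial {p : Matrix n n ℂ} (hp : p ∈ (trivial n).proj) : p = 1 :=
  Finset.mem_singleton.1 (Finset.mem_erase.1 hp).2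

/-- Distinct pairs of projectors of two commuting decompositions have orthogonal products. -/
theorem mul_mul_mul_eq_zero (P Q : ProjectiveDecomposition n)
    (h : ∀ p ∈ P.proj, ∀ q ∈ Q.proj, Commute p q) {x y : Matrix n n ℂ × Matrix n n ℂ}
    (hx : x ∈ P.proj ×ˢ Q.proj) (hy : y ∈ P.proj ×ˢ Q.proj) (hne : x ≠ y) :
    x.1 * x.2 * (y.1 * y.2) = 0 := by
  rw [Finset.mem_product] at hx hy
  rw [(h y.1 hy.1 x.2 hx.2).symm.mul_mul_mul_comm, P.mul_eq_ite hx.1 hy.1, Q.mul_eq_ite hx.2 hy.2]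
  split_ifs with h1 h2
  · exact absurd (Prod.ext h1 h2) hne
  all_goals simp

theorem isStarProjection_mul (P Q : ProjectiveDecomposition n)
    (h : ∀ p ∈ P.proj, ∀ q ∈ Q.proj, Commute p q) {x : Matrix n n ℂ × Matrix n n ℂ}
    (hx : x ∈ P.proj ×ˢ Q.proj) : IsStarProjection (x.1 * x.2) := by
  rw [Finset.mem_product] at hx
  exact (P.isStarProjection _ hx.1).mul (Q.isStarProjection _ hx.2) (h _ hx.1 _ hx.2)

theorem sum_image_mul_eq_one (P Q : ProjectiveDecomposition n)
    (h : ∀ p ∈ P.proj, ∀ q ∈ Q.proj, Commute p q) :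
    ∑ r ∈ (P.proj ×ˢ Q.proj).image fun x => x.1 * x.2, r = 1 := by
  rw [Finset.sum_image_of_pairwise_eq_zero (g := fun p => p), Finset.sum_product,
    ← Finset.sum_mul_sum, P.sum_eq_one, Q.sum_eq_one, mul_one]
  intro x hx y hy hne heq
  have hxx : x.1 * x.2 * (x.1 * x.2) = x.1 * x.2 :=
    (isStarProjection_mul P Q h hx).isIdempotentElem
  rw [← hxx]
  nth_rw 2 [heq]
  exact mul_mul_mul_eq_zero P Q h hx hy hne

/-- The common refinement of two commuting decompositions: its projectors are the nonzero products
of projectors of the two. -/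
noncomputable def refine (P Q : ProjectiveDecomposition n)
    (h : ∀ p ∈ P.proj, ∀ q ∈ Q.proj, Commute p q) : ProjectiveDecomposition n where
  proj := ((P.proj ×ˢ Q.proj).image fun x => x.1 * x.2).erase 0
  isStarProjection R hR := by
    obtain ⟨x, hx, rfl⟩ := Finset.mem_image.1 (Finset.mem_erase.1 hR).2
    exact isStarProjection_mul P Q h hx
  ne_zero R hR := (Finset.mem_erase.1 hR).1
  orthogonal R hR R' hR' hne := by
    obtain ⟨x, hx, rfl⟩ := Finset.mem_image.1 (Finset.mem_erase.1 hR).2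
    obtain ⟨y, hy, rfl⟩ := Finset.mem_image.1 (Finset.mem_erase.1 hR').2
    exact mul_mul_mul_eq_zero P Q h hx hy fun hxy => hne (by rw [hxy])
  sum_eq_one := by
    rw [Finset.sum_erase (a := 0) (f := fun p => p) _ rfl, sum_image_mul_eq_one P Q h]

theorem exists_of_mem_refine {P Q : ProjectiveDecomposition n}
    {h : ∀ p ∈ P.proj, ∀ q ∈ Q.proj, Commute p q} {x : Matrix n n ℂ}
    (hx : x ∈ (P.refine Q h).proj) : ∃ p ∈ P.proj, ∃ q ∈ Q.proj, p * q = x := by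
  obtain ⟨⟨p, q⟩, hpq, rfl⟩ := Finset.mem_image.1 (Finset.mem_erase.1 hx).2
  rw [Finset.mem_product] at hpq
  exact ⟨p, hpq.1, q, hpq.2, rfl⟩

theorem mul_mem_span_refine {P Q : ProjectiveDecomposition n}
    (h : ∀ p ∈ P.proj, ∀ q ∈ Q.proj, Commute p q) {p q : Matrix n n ℂ} (hp : p ∈ P.proj)
    (hq : q ∈ Q.proj) :
    p * q ∈ Submodule.span ℂ ((P.refine Q h).proj : Set (Matrix n n ℂ)) := by
  by_cases h0 : p * q = 0
  · rw [h0]; exact zero_mem _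
  · exact Submodule.subset_span (Finset.mem_erase.2
      ⟨h0, Finset.mem_image.2 ⟨(p, q), Finset.mem_product.2 ⟨hp, hq⟩, rfl⟩⟩)

theorem left_subset_span_refine {P Q : ProjectiveDecomposition n}
    (h : ∀ p ∈ P.proj, ∀ q ∈ Q.proj, Commute p q) :
    (P.proj : Set (Matrix n n ℂ)) ⊆
      Submodule.span ℂ ((P.refine Q h).proj : Set (Matrix n n ℂ)) := by
  intro p hp
  rw [← mul_one p, ← Q.sum_eq_one, Finset.mul_sum]
  exact sum_mem fun q hq => mul_mem_span_refine h hp hq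

theorem right_subset_span_refine {P Q : ProjectiveDecomposition n}
    (h : ∀ p ∈ P.proj, ∀ q ∈ Q.proj, Commute p q) :
    (Q.proj : Set (Matrix n n ℂ)) ⊆
      Submodule.span ℂ ((P.refine Q h).proj : Set (Matrix n n ℂ)) := by
  intro q hq
  rw [← one_mul q, ← P.sum_eq_one, Finset.sum_mul]
  exact sum_mem fun p hp => mul_mem_span_refine h hp hq

/-- Every nonzero projector `r` belongs to a decomposition, namely `{r, 1 - r}` without `0`. -/
theorem exists_mem_proj {r : Matrix n n ℂ} (hr : IsStarProjection r) (h0 : r ≠ 0) :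
    ∃ P : ProjectiveDecomposition n, r ∈ P.proj := by
  have hrr : r * r = r := hr.isIdempotentElem
  have h1 : r * (1 - r) = 0 := by rw [mul_sub, mul_one, hrr, sub_self]
  have h2 : (1 - r) * r = 0 := by rw [sub_mul, one_mul, hrr, sub_self]
  refine ⟨⟨({r, 1 - r} : Finset _).erase 0, ?_, ?_, ?_, ?_⟩, ?_⟩
  · intro P hP
    simp only [Finset.mem_erase, Finset.mem_insert, Finset.mem_singleton] at hP
    rcases hP.2 with rfl | rfl
    · exact hr
    · exact hr.one_sub
  · intro P hP
    exact (Finset.mem_erase.1 hP).1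
  · intro P hP Q hQ hne
    simp only [Finset.mem_erase, Finset.mem_insert, Finset.mem_singleton] at hP hQ
    rcases hP.2 with rfl | rfl <;> rcases hQ.2 with rfl | rfl
    · exact absurd rfl hne
    · exact h1
    · exact h2
    · exact absurd rfl hne
  · rw [Finset.sum_erase (a := 0) (f := fun p => p) _ rfl, Finset.sum_pair, add_sub_cancel]
    intro h
    exact h0 (by rw [← hrr]; nth_rw 2 [h]; exact h1)
  · exact Finset.mem_erase.2 ⟨h0, Finset.mem_insert_self _ _⟩

end ProjectiveDecomposition

/-- The projectors span all matrices: a Hermitian matrix is a combination of its spectral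
projectors. -/
theorem Matrix.span_isStarProjection (n : Type*) [Fintype n] [DecidableEq n] :
    Submodule.span ℂ {p : Matrix n n ℂ | IsStarProjection p} = ⊤ := by
  have herm : ∀ H : Matrix n n ℂ, H.IsHermitian →
      H ∈ Submodule.span ℂ {p : Matrix n n ℂ | IsStarProjection p} := by
    intro H hH
    set V : Matrix n n ℂ := (hH.eigenvectorUnitary : Matrix n n ℂ) with hV
    have hVV : star V * V = 1 := Unitary.coe_star_mul_self hH.eigenvectorUnitary
    have hsum : H = ∑ i, (hH.eigenvalues i : ℂ) • (V * single i i 1 * star V) := by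
      have hd : diagonal (RCLike.ofReal ∘ hH.eigenvalues : n → ℂ) =
          ∑ i, (hH.eigenvalues i : ℂ) • single i i (1 : ℂ) := by
        rw [← sum_single_eq_diagonal]
        simp [smul_single]
      have hs := hH.spectral_theorem
      rw [Unitary.conjStarAlgAut_apply, hd] at hs
      refine hs.trans ?_
      simp only [Finset.mul_sum, Finset.sum_mul, mul_smul_comm, smul_mul_assoc, hV]
    rw [hsum]
    refine sum_mem fun i _ => Submodule.smul_mem _ _ (Submodule.subset_span ⟨?_, ?_⟩)
    · change V * single i i 1 * star V * (V * single i i 1 * star V) = _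
      rw [show V * single i i (1 : ℂ) * star V * (V * single i i 1 * star V) =
        V * single i i 1 * (star V * V) * single i i 1 * star V by simp only [mul_assoc], hVV,
        mul_one, mul_assoc V, single_mul_single_same, one_mul]
    · change star (V * single i i (1 : ℂ) * star V) = _
      rw [star_mul, star_mul, star_star, star_eq_conjTranspose (single i i (1 : ℂ)),
        conjTranspose_single, star_one, mul_assoc]
  rw [eq_top_iff]
  intro x _
  rw [← realPart_add_I_smul_imaginaryPart x]
  exact add_mem (herm _ (realPart x).2) (Submodule.smul_mem _ _ (herm _ (imaginaryPart x).2))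

section Preference

variable {a b c d : Type*} [Fintype a] [DecidableEq a] [Fintype b] [DecidableEq b]
  [Fintype c] [DecidableEq c] [Fintype d] [DecidableEq d]

/-- Absence of interference influence on all decompositions of `D` means commutation with all
operators on `D`, since projectors span them. -/
theorem PrefCondOne.commute {U : Matrix (c × d) (a × b) ℂ} {P : ProjectiveDecomposition a}
    (h : PrefCondOne U P) {p : Matrix a a ℂ} (hp : p ∈ P.proj) (q : Matrix d d ℂ) :
    Commute (p ⊗ₖ (1 : Matrix b b ℂ)) (Uᴴ * ((1 : Matrix c c ℂ) ⊗ₖ q) * U) := by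
  have hq : q ∈ Submodule.span ℂ {p : Matrix d d ℂ | IsStarProjection p} := by
    rw [Matrix.span_isStarProjection]; trivial
  induction hq using Submodule.span_induction with
  | mem r hr =>
    by_cases h0 : r = 0
    · simp [h0]
    · obtain ⟨Q, hQ⟩ := ProjectiveDecomposition.exists_mem_proj hr h0
      exact h Q p hp r hQ
  | zero => simp
  | add x y _ _ hx hy =>
    rw [kronecker_add, Matrix.mul_add, Matrix.add_mul]; exact hx.add_right hy
  | smul k x _ hx =>
    rw [kronecker_smul, Matrix.mul_smul, Matrix.smul_mul]; exact hx.smul_right k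

theorem prefCondOne_trivial (U : Matrix (c × d) (a × b) ℂ) :
    PrefCondOne U (ProjectiveDecomposition.trivial a) := by
  intro Q p hp q _
  rw [ProjectiveDecomposition.eq_one_of_mem_trivial hp, one_kronecker_one]
  exact Commute.one_left _

theorem prefCondTwo_trivial (U : Matrix (c × d) (a × b) ℂ) :
    PrefCondTwo U (ProjectiveDecomposition.trivial a) := by
  rintro R ⟨p, hp, r, _, hpr⟩
  rw [ProjectiveDecomposition.eq_one_of_mem_trivial hp] at hpr
  exact absurd (Commute.one_left _) hpr

theorem PrefCondTwo.commute {U : Matrix (c × d) (a × b) ℂ} {P R : ProjectiveDecomposition a}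
    (h : PrefCondTwo U P) (hR : PrefCondOne U R) {p r : Matrix a a ℂ} (hp : p ∈ P.proj)
    (hr : r ∈ R.proj) : Commute p r := by
  by_contra hc
  obtain ⟨Q, hQ⟩ := h R ⟨p, hp, r, hr, hc⟩
  exact hQ (hR Q)

theorem PrefCondOne.refine {U : Matrix (c × d) (a × b) ℂ} {P R : ProjectiveDecomposition a}
    (hP : PrefCondOne U P) (hR : PrefCondOne U R)
    (h : ∀ p ∈ P.proj, ∀ r ∈ R.proj, Commute p r) : PrefCondOne U (P.refine R h) := by
  intro Q x hx q hq
  obtain ⟨p, hp, r, hr, rfl⟩ := ProjectiveDecomposition.exists_of_mem_refine hx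
  rw [← one_mul (1 : Matrix b b ℂ), mul_kronecker_mul]
  exact (hP Q p hp q hq).mul_left (hR Q r hr q hq)

theorem PrefCondTwo.refine {U : Matrix (c × d) (a × b) ℂ} {P R : ProjectiveDecomposition a}
    (hP : PrefCondTwo U P) (hR : PrefCondTwo U R)
    (h : ∀ p ∈ P.proj, ∀ r ∈ R.proj, Commute p r) : PrefCondTwo U (P.refine R h) := by
  rintro S ⟨x, hx, s, hs, hxs⟩
  by_contra! hS
  obtain ⟨p, hp, r, hr, rfl⟩ := ProjectiveDecomposition.exists_of_mem_refine hx
  exact hxs ((hP.commute hS hp hs).mul_left (hR.commute hS hr hs))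

/-- The preferred decomposition exists and is unique. It is the decomposition with maximal span
among those that satisfy the first two conditions: any other one commutes with it, and the common
refinement cannot have a larger span. -/
theorem existsUnique_isPreferredBy (U : Matrix (c × d) (a × b) ℂ) :
    ∃! P : ProjectiveDecomposition a, IsPreferredBy U P := by
  obtain ⟨s, ⟨P, ⟨hP1, hP2⟩, rfl⟩, hmax⟩ :=
    (wellFounded_gt (α := Submodule ℂ (Matrix a a ℂ))).has_min
    ((fun P : ProjectiveDecomposition a => Submodule.span ℂ (P.proj : Set (Matrix a a ℂ))) ''
      {P | PrefCondOne U P ∧ PrefCondTwo U P})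
    ⟨_, _, ⟨prefCondOne_trivial U, prefCondTwo_trivial U⟩, rfl⟩
  have hle : ∀ R : ProjectiveDecomposition a, PrefCondOne U R → PrefCondTwo U R →
      (R.proj : Set (Matrix a a ℂ)) ⊆ Submodule.span ℂ (P.proj : Set (Matrix a a ℂ)) := by
    intro R hR1 hR2
    have hc : ∀ p ∈ P.proj, ∀ r ∈ R.proj, Commute p r := fun p hp r hr => hP2.commute hR1 hp hr
    have hle := Submodule.span_le.2 (ProjectiveDecomposition.left_subset_span_refine hc)
    have heq := eq_of_le_of_not_lt hle (hmax _ ⟨_, ⟨hP1.refine hR1 hc, hP2.refine hR2 hc⟩, rfl⟩)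
    rw [heq]
    exact ProjectiveDecomposition.right_subset_span_refine hc
  exact ⟨P, ⟨hP1, hP2, hle⟩, fun R hR =>
    ProjectiveDecomposition.eq_of_subset_span (hle R hR.1 hR.2.1) (hR.2.2 P hP1 hP2)⟩

end Preference

/-! ### Operators that act trivially on a tensor factor -/

section Locality

variable {I : Type*} [Fintype I] [DecidableEq I] {x : I → ℕ}

theorem onFactor_apply (i : I) (M : Matrix (Fin (x i)) (Fin (x i)) ℂ) (p q : ∀ j, Fin (x j)) :
    onFactor x i M p q = if ∀ j, j ≠ i → p j = q j then M (p i) (q i) else 0 := by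
  simp only [onFactor, submatrix_apply, kroneckerMap_apply, Equiv.piSplitAt_apply, one_apply,
    funext_iff, Subtype.forall]
  split_ifs <;> simp

theorem onFactor_mul_apply {m : Type*} (i : I) (M : Matrix (Fin (x i)) (Fin (x i)) ℂ)
    (O : Matrix (∀ j, Fin (x j)) m ℂ) (p : ∀ j, Fin (x j)) (q : m) :
    (onFactor x i M * O) p q = ∑ a, M (p i) a * O (Function.update p i a) q := by
  rw [mul_apply, ← Finset.sum_subset (Finset.subset_univ
    (Finset.univ.image fun a => Function.update p i a)), Finset.sum_image]
  · refine Finset.sum_congr rfl fun a _ => ?_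
    rw [onFactor_apply, if_pos, Function.update_self]
    intro j hj
    rw [Function.update_of_ne hj]
  · intro a _ b _ h
    simpa using congrFun h i
  · intro r _ hr
    rw [onFactor_apply, if_neg, zero_mul]
    intro h
    refine hr (Finset.mem_image.2 ⟨r i, Finset.mem_univ _, ?_⟩)
    funext j
    by_cases hj : j = i
    · subst hj; simp
    · rw [Function.update_of_ne hj, h j hj]

theorem mul_onFactor_apply {m : Type*} (i : I) (M : Matrix (Fin (x i)) (Fin (x i)) ℂ)
    (O : Matrix m (∀ j, Fin (x j)) ℂ) (p : m) (q : ∀ j, Fin (x j)) :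
    (O * onFactor x i M) p q = ∑ a, O p (Function.update q i a) * M a (q i) := by
  rw [mul_apply, ← Finset.sum_subset (Finset.subset_univ
    (Finset.univ.image fun a => Function.update q i a)), Finset.sum_image]
  · refine Finset.sum_congr rfl fun a _ => ?_
    rw [onFactor_apply, if_pos, Function.update_self]
    intro j hj
    rw [Function.update_of_ne hj]
  · intro a _ b _ h
    simpa using congrFun h i
  · intro r _ hr
    rw [onFactor_apply, if_neg, mul_zero]
    intro h
    refine hr (Finset.mem_image.2 ⟨r i, Finset.mem_univ _, ?_⟩)
    funext j
    by_cases hj : j = i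
    · subst hj; simp
    · rw [Function.update_of_ne hj, h j hj]

theorem onFactor_mul (i : I) (M N : Matrix (Fin (x i)) (Fin (x i)) ℂ) :
    onFactor x i (M * N) = onFactor x i M * onFactor x i N := by
  rw [onFactor, onFactor, onFactor, submatrix_mul_equiv, ← mul_kronecker_mul, one_mul]

theorem onFactor_one (i : I) : onFactor x i 1 = 1 := by
  rw [onFactor, one_kronecker_one, submatrix_one_equiv]

theorem onFactor_conjTranspose (i : I) (M : Matrix (Fin (x i)) (Fin (x i)) ℂ) :
    (onFactor x i M)ᴴ = onFactor x i Mᴴ := by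
  rw [onFactor, onFactor, conjTranspose_submatrix, conjTranspose_kronecker, conjTranspose_one]

theorem onFactor_add (i : I) (M N : Matrix (Fin (x i)) (Fin (x i)) ℂ) :
    onFactor x i (M + N) = onFactor x i M + onFactor x i N := by
  rw [onFactor, onFactor, onFactor, add_kronecker]; rfl

theorem onFactor_zero (i : I) : onFactor x i 0 = 0 := by
  rw [onFactor, zero_kronecker]; rfl

/-- The operator `O` on `⨂ i, ℂ^(x i)` acts as the identity on the tensor factor `i`, expressed by
its matrix elements. -/
def ActsTriviallyOn (O : Matrix (∀ j, Fin (x j)) (∀ j, Fin (x j)) ℂ) (i : I) : Prop :=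
  (∀ p q, p i ≠ q i → O p q = 0) ∧
    ∀ p q a, p i = q i → O (Function.update p i a) (Function.update q i a) = O p q

theorem ActsTriviallyOn.commute {O : Matrix (∀ j, Fin (x j)) (∀ j, Fin (x j)) ℂ} {i : I}
    (h : ActsTriviallyOn O i) (M : Matrix (Fin (x i)) (Fin (x i)) ℂ) :
    Commute O (onFactor x i M) := by
  ext p q
  rw [mul_onFactor_apply, onFactor_mul_apply, Finset.sum_eq_single (p i),
    Finset.sum_eq_single (q i)]
  · rw [mul_comm]
    congr 1
    have := h.2 (Function.update p i (q i)) q (p i) (by simp)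
    rw [← this]
    simp
  · intro a _ ha
    rw [h.1 _ _ (by simpa using ha), mul_zero]
  · simp
  · intro a _ ha
    rw [h.1 _ _ (by simpa using ha.symm), zero_mul]
  · simp

theorem ActsTriviallyOn.of_commute {O : Matrix (∀ j, Fin (x j)) (∀ j, Fin (x j)) ℂ} {i : I}
    (h : ∀ M, Commute O (onFactor x i M)) : ActsTriviallyOn O i := by
  have key : ∀ p q a b, (if b = q i then O p (Function.update q i a) else 0) =
      if p i = a then O (Function.update p i b) q else 0 := by
    intro p q a b
    have := congrFun (congrFun (h (single a b 1)).eq p) q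
    rw [mul_onFactor_apply, onFactor_mul_apply] at this
    simpa [single_apply, ite_and, eq_comm] using this
  refine ⟨fun p q hpq => ?_, fun p q a hpq => ?_⟩
  · have := key p q (q i) (q i)
    rwa [if_pos rfl, if_neg hpq, Function.update_eq_self] at this
  · have := key (Function.update p i a) q a (q i)
    simp only [if_true, Function.update_self, Function.update_idem] at this
    rw [this, ← hpq, Function.update_eq_self]

theorem actsTriviallyOn_onFactor {i j : I} (hij : i ≠ j) (M : Matrix (Fin (x i)) (Fin (x i)) ℂ) :
    ActsTriviallyOn (onFactor x i M) j := by
  refine ⟨fun p q h => ?_, fun p q a h => ?_⟩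
  · rw [onFactor_apply, if_neg]
    exact fun h' => h (h' j hij.symm)
  · rw [onFactor_apply, onFactor_apply, Function.update_of_ne hij, Function.update_of_ne hij]
    congr 1
    refine propext (forall_congr' fun k => imp_congr_right fun _ => ?_)
    by_cases hk : k = j
    · subst hk; simp [h]
    · rw [Function.update_of_ne hk, Function.update_of_ne hk]

/-- If `O` acts as the identity on the factors in `T`, a nonzero matrix element requires equal
labels on `T` and does not depend on them. -/
theorem apply_eq_of_actsTriviallyOn {O : Matrix (∀ j, Fin (x j)) (∀ j, Fin (x j)) ℂ}
    {T : Set I} (hT : ∀ i ∈ T, ActsTriviallyOn O i) {p p' q q' : ∀ j, Fin (x j)}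
    (hpq : ∀ i ∉ T, p i = q i) (hpq' : ∀ i ∉ T, p' i = q' i)
    (h : (∀ i ∈ T, p i = p' i) ↔ ∀ i ∈ T, q i = q' i) : O p p' = O q q' := by
  classical
  by_cases hp : ∀ i ∈ T, p i = p' i
  · have main : ∀ S : Finset I, (∀ i ∈ S, ActsTriviallyOn O i) → ∀ p p' : ∀ j, Fin (x j),
        (∀ i ∈ S, p i = p' i) → (∀ i ∉ S, p i = q i) → (∀ i ∉ S, p' i = q' i) →
        (∀ i ∈ S, q i = q' i) → O p p' = O q q' := by
      intro S
      induction S using Finset.induction_on with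
      | empty =>
        intro _ p p' _ h1 h2 _
        rw [show p = q from funext fun i => h1 i (by simp),
          show p' = q' from funext fun i => h2 i (by simp)]
      | insert i S hi ih =>
        intro hS p p' h0 h1 h2 h3
        rw [← (hS i (Finset.mem_insert_self _ _)).2 p p' (q i) (h0 i (Finset.mem_insert_self _ _))]
        have hq := h3 i (Finset.mem_insert_self _ _)
        refine ih (fun k hk => hS k (Finset.mem_insert_of_mem hk)) _ _ ?_ ?_ ?_ ?_
        · intro k hk
          have : k ≠ i := by rintro rfl; exact hi hk
          rw [Function.update_of_ne this, Function.update_of_ne this]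
          exact h0 k (Finset.mem_insert_of_mem hk)
        · intro k hk
          by_cases hki : k = i
          · subst hki; simp
          · rw [Function.update_of_ne hki]; exact h1 k (by simp [hki, hk])
        · intro k hk
          by_cases hki : k = i
          · subst hki; simp [hq]
          · rw [Function.update_of_ne hki]; exact h2 k (by simp [hki, hk])
        · exact fun k hk => h3 k (Finset.mem_insert_of_mem hk)
    exact main (Finset.univ.filter (· ∈ T)) (by simpa using hT) p p' (by simpa using hp)
      (by simpa using hpq) (by simpa using hpq') (by simpa using h.1 hp)
  · have hq : ¬ ∀ i ∈ T, q i = q' i := fun hq => hp (h.2 hq)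
    push Not at hp hq
    obtain ⟨i, hi, hpi⟩ := hp
    obtain ⟨j, hj, hqj⟩ := hq
    rw [(hT i hi).1 _ _ hpi, (hT j hj).1 _ _ hqj]

end Locality

/-! ### Evolution through the gates of a circuit -/

namespace UnitaryCircuit

variable {W : Type*} [Fintype W] [DecidableEq W] (C : UnitaryCircuit W)

/-- The wires that the gate `g` leaves alone. -/
abbrev Bystander (g : Fin C.numGates) : Type _ := {w : W // C.Live g.succ w ∧ C.Live g.castSucc w}

theorem not_live_succ_of_target {g : Fin C.numGates} {w : W} (h : C.target w = some g) :
    ¬ C.Live g.succ w := fun hw => absurd (hw.2 g h) (by simp [Fin.le_def])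

theorem not_live_castSucc_of_source {g : Fin C.numGates} {w : W} (h : C.source w = some g) :
    ¬ C.Live g.castSucc w := fun hw => absurd (hw.1 g h) (by simp [Fin.le_def])

theorem live_castSucc_of_succ {g : Fin C.numGates} {w : W} (hw : C.Live g.succ w)
    (h : C.source w ≠ some g) : C.Live g.castSucc w := by
  refine ⟨fun k hk => ?_, fun k hk => g.castSucc_lt_succ.le.trans (hw.2 k hk)⟩
  have h1 := hw.1 k hk
  have h2 : k ≠ g := by rintro rfl; exact h hk
  rw [Fin.le_def] at h1 ⊢
  rw [ne_eq, Fin.ext_iff] at h2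
  simp only [Fin.val_succ, Fin.val_castSucc] at *
  omega

theorem live_succ_of_castSucc {g : Fin C.numGates} {w : W} (hw : C.Live g.castSucc w)
    (h : C.target w ≠ some g) : C.Live g.succ w := by
  refine ⟨fun k hk => (hw.1 k hk).trans g.castSucc_lt_succ.le, fun k hk => ?_⟩
  have h1 := hw.2 k hk
  have h2 : k ≠ g := by rintro rfl; exact h hk
  rw [Fin.le_def] at h1 ⊢
  rw [ne_eq, Fin.ext_iff] at h2
  simp only [Fin.val_succ, Fin.val_castSucc] at *
  omega

/-- The labels after the gate `g`, as labels of the outputs of `g` and of the bystanders. -/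
def splitOut (g : Fin C.numGates) : C.Basis g.succ ≃
    (∀ w : {w // C.source w = some g}, Fin (C.dim w)) × (∀ w : C.Bystander g, Fin (C.dim w)) where
  toFun p := (fun w => p ⟨w.1, C.live_of_source w.2⟩, fun w => p ⟨w.1, w.2.1⟩)
  invFun a w := if h : C.source w.1 = some g then a.1 ⟨w.1, h⟩ else
    a.2 ⟨w.1, w.2, C.live_castSucc_of_succ w.2 h⟩
  left_inv p := by funext w; dsimp only; split_ifs <;> rfl
  right_inv a := by
    refine Prod.ext (funext fun w => ?_) (funext fun w => ?_)
    · exact dif_pos w.2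
    · exact dif_neg fun h => C.not_live_castSucc_of_source h w.2.2

/-- The labels before the gate `g`, as labels of the inputs of `g` and of the bystanders. -/
def splitIn (g : Fin C.numGates) : C.Basis g.castSucc ≃
    (∀ w : {w // C.target w = some g}, Fin (C.dim w)) × (∀ w : C.Bystander g, Fin (C.dim w)) where
  toFun p := (fun w => p ⟨w.1, C.live_of_target w.2⟩, fun w => p ⟨w.1, w.2.2⟩)
  invFun a w := if h : C.target w.1 = some g then a.1 ⟨w.1, h⟩ else
    a.2 ⟨w.1, C.live_succ_of_castSucc w.2 h, w.2⟩
  left_inv p := by funext w; dsimp only; split_ifs <;> rfl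
  right_inv a := by
    refine Prod.ext (funext fun w => ?_) (funext fun w => ?_)
    · exact dif_pos w.2
    · exact dif_neg fun h => C.not_live_succ_of_target h w.2.1

theorem step_eq (g : Fin C.numGates) :
    C.step g = (C.gate g ⊗ₖ (1 : Matrix (∀ w : C.Bystander g, Fin (C.dim w)) _ ℂ)).submatrix
      (C.splitOut g) (C.splitIn g) := by
  ext p q
  simp only [step, of_apply, submatrix_apply, kroneckerMap_apply, one_apply]
  have : (∀ (w : W) (h : C.Live g.succ w) (h' : C.Live g.castSucc w), p ⟨w, h⟩ = q ⟨w, h'⟩) ↔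
      (C.splitOut g p).2 = (C.splitIn g q).2 :=
    ⟨fun h => funext fun w => h w.1 w.2.1 w.2.2, fun h w h1 h2 => congrFun h ⟨w, h1, h2⟩⟩
  by_cases h : (C.splitOut g p).2 = (C.splitIn g q).2
  · rw [if_pos h, if_pos (this.2 h), mul_one]; rfl
  · rw [if_neg h, if_neg (fun h' => h (this.1 h')), mul_zero]

theorem step_conjTranspose_mul (g : Fin C.numGates) : (C.step g)ᴴ * C.step g = 1 := by
  rw [step_eq, conjTranspose_submatrix, submatrix_mul_equiv, conjTranspose_kronecker,
    ← mul_kronecker_mul, C.gate_conjTranspose_mul, conjTranspose_one, one_mul, one_kronecker_one,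
    submatrix_one_equiv]

theorem step_mul_conjTranspose (g : Fin C.numGates) : C.step g * (C.step g)ᴴ = 1 := by
  rw [step_eq, conjTranspose_submatrix, submatrix_mul_equiv, conjTranspose_kronecker,
    ← mul_kronecker_mul, C.gate_mul_conjTranspose, conjTranspose_one, one_mul, one_kronecker_one,
    submatrix_one_equiv]

theorem evol_zero : C.evol 0 = 1 := rfl

theorem evol_succ (g : Fin C.numGates) : C.evol g.succ = C.step g * C.evol g.castSucc :=
  Fin.induction_succ _ _ _

theorem evol_conjTranspose_mul (t : Fin (C.numGates + 1)) : (C.evol t)ᴴ * C.evol t = 1 := by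
  induction t using Fin.induction with
  | zero => rw [evol_zero, conjTranspose_one, one_mul]
  | succ g ih =>
    rw [evol_succ, conjTranspose_mul, Matrix.mul_assoc, ← Matrix.mul_assoc _ (C.step g),
      step_conjTranspose_mul, Matrix.one_mul, ih]

theorem evol_mul_conjTranspose (t : Fin (C.numGates + 1)) : C.evol t * (C.evol t)ᴴ = 1 := by
  induction t using Fin.induction with
  | zero => rw [evol_zero, conjTranspose_one, one_mul]
  | succ g ih =>
    rw [evol_succ, conjTranspose_mul, Matrix.mul_assoc, ← Matrix.mul_assoc (C.evol _), ih,
      Matrix.one_mul, step_mul_conjTranspose]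

/-! ### Heisenberg operators and the light cone of a wire -/

/-- The operator `V H V†` after `t` gates, where `V` is the unitary implemented by these gates. It
undoes the Heisenberg representation. -/
def push (t : Fin (C.numGates + 1)) (H : Matrix (C.Basis 0) (C.Basis 0) ℂ) :
    Matrix (C.Basis t) (C.Basis t) ℂ :=
  C.evol t * H * (C.evol t)ᴴ

theorem push_mul (t : Fin (C.numGates + 1)) (H K : Matrix (C.Basis 0) (C.Basis 0) ℂ) :
    C.push t (H * K) = C.push t H * C.push t K := by
  simp only [push, Matrix.mul_assoc]
  rw [← Matrix.mul_assoc (C.evol t)ᴴ (C.evol t), evol_conjTranspose_mul, Matrix.one_mul]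

theorem push_injective (t : Fin (C.numGates + 1)) : Function.Injective (C.push t) := by
  intro H K h
  have := congrArg (fun M => (C.evol t)ᴴ * M * C.evol t) h
  simpa only [push, ← Matrix.mul_assoc, evol_conjTranspose_mul, Matrix.one_mul,
    Matrix.mul_assoc _ _ (C.evol t), Matrix.mul_one] using this

theorem commute_push_iff (t : Fin (C.numGates + 1)) {H K : Matrix (C.Basis 0) (C.Basis 0) ℂ} :
    Commute (C.push t H) (C.push t K) ↔ Commute H K := by
  rw [Commute, SemiconjBy, ← push_mul, ← push_mul, (C.push_injective t).eq_iff]; rfl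

theorem push_succ (g : Fin C.numGates) (H : Matrix (C.Basis 0) (C.Basis 0) ℂ) :
    C.push g.succ H = C.step g * C.push g.castSucc H * (C.step g)ᴴ := by
  simp only [push, evol_succ, conjTranspose_mul, Matrix.mul_assoc]

theorem push_castSucc (g : Fin C.numGates) (H : Matrix (C.Basis 0) (C.Basis 0) ℂ) :
    C.push g.castSucc H = (C.step g)ᴴ * C.push g.succ H * C.step g := by
  rw [push_succ]
  simp only [← Matrix.mul_assoc]
  rw [step_conjTranspose_mul, Matrix.one_mul, Matrix.mul_assoc, step_conjTranspose_mul,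
    Matrix.mul_one]

/-- The labels after the gate `g` that are `a` on its outputs and `q` on the bystanders. -/
abbrev glueOut (g : Fin C.numGates) (a : ∀ w : {w // C.source w = some g}, Fin (C.dim w))
    (q : C.Basis g.castSucc) : C.Basis g.succ :=
  (C.splitOut g).symm (a, (C.splitIn g q).2)

/-- The labels before the gate `g` that are `b` on its inputs and `p` on the bystanders. -/
abbrev glueIn (g : Fin C.numGates) (b : ∀ w : {w // C.target w = some g}, Fin (C.dim w))
    (p : C.Basis g.succ) : C.Basis g.castSucc :=
  (C.splitIn g).symm (b, (C.splitOut g p).2)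

theorem glueOut_of_source {g : Fin C.numGates} (a q) {w : C.Slice g.succ}
    (h : C.source w.1 = some g) : C.glueOut g a q w = a ⟨w.1, h⟩ := dif_pos h

theorem glueOut_of_live {g : Fin C.numGates} (a q) {w : C.Slice g.succ}
    (h : C.Live g.castSucc w.1) : C.glueOut g a q w = q ⟨w.1, h⟩ :=
  dif_neg fun h' => C.not_live_castSucc_of_source h' h

theorem glueIn_of_target {g : Fin C.numGates} (b p) {w : C.Slice g.castSucc}
    (h : C.target w.1 = some g) : C.glueIn g b p w = b ⟨w.1, h⟩ := dif_pos h

theorem glueIn_of_live {g : Fin C.numGates} (b p) {w : C.Slice g.castSucc}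
    (h : C.Live g.succ w.1) : C.glueIn g b p w = p ⟨w.1, h⟩ :=
  dif_neg fun h' => C.not_live_succ_of_target h' h

theorem sum_mul_step (g : Fin C.numGates) (f : C.Basis g.succ → ℂ) (q : C.Basis g.castSucc) :
    ∑ p, f p * C.step g p q =
      ∑ a, f (C.glueOut g a q) * C.gate g a (C.splitIn g q).1 := by
  rw [step_eq, ← (C.splitOut g).symm.sum_comp, Fintype.sum_prod_type]
  refine Finset.sum_congr rfl fun a _ => ?_
  rw [Finset.sum_eq_single (C.splitIn g q).2]
  · simp
  · intro c _ hc
    simp [hc]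
  · simp

theorem sum_step_mul (g : Fin C.numGates) (f : C.Basis g.castSucc → ℂ) (p : C.Basis g.succ) :
    ∑ q, C.step g p q * f q =
      ∑ b, C.gate g (C.splitOut g p).1 b * f (C.glueIn g b p) := by
  rw [step_eq, ← (C.splitIn g).symm.sum_comp, Fintype.sum_prod_type]
  refine Finset.sum_congr rfl fun b _ => ?_
  rw [Finset.sum_eq_single (C.splitOut g p).2]
  · simp
  · intro c _ hc
    simp [hc.symm]
  · simp

theorem sum_star_step_mul (g : Fin C.numGates) (f : C.Basis g.succ → ℂ) (q : C.Basis g.castSucc) :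
    ∑ p, star (C.step g p q) * f p =
      ∑ a, star (C.gate g a (C.splitIn g q).1) * f (C.glueOut g a q) := by
  rw [step_eq, ← (C.splitOut g).symm.sum_comp, Fintype.sum_prod_type]
  refine Finset.sum_congr rfl fun a _ => ?_
  rw [Finset.sum_eq_single (C.splitIn g q).2]
  · simp
  · intro c _ hc
    simp [hc]
  · simp

theorem sum_mul_star_step (g : Fin C.numGates) (f : C.Basis g.castSucc → ℂ) (p : C.Basis g.succ) :
    ∑ q, f q * star (C.step g p q) =
      ∑ b, f (C.glueIn g b p) * star (C.gate g (C.splitOut g p).1 b) := by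
  rw [step_eq, ← (C.splitIn g).symm.sum_comp, Fintype.sum_prod_type]
  refine Finset.sum_congr rfl fun b _ => ?_
  rw [Finset.sum_eq_single (C.splitOut g p).2]
  · simp
  · intro c _ hc
    simp [hc.symm]
  · simp

theorem conjTranspose_mul_mul_step_apply (g : Fin C.numGates)
    (O : Matrix (C.Basis g.succ) (C.Basis g.succ) ℂ)
    (q q' : C.Basis g.castSucc) :
    ((C.step g)ᴴ * O * C.step g) q q' =
      ∑ a', (∑ a, star (C.gate g a (C.splitIn g q).1) *
        O (C.glueOut g a q) (C.glueOut g a' q')) * C.gate g a' (C.splitIn g q').1 := by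
  rw [mul_apply, sum_mul_step]
  refine Finset.sum_congr rfl fun a' _ => ?_
  rw [mul_apply]
  simp only [conjTranspose_apply]
  rw [sum_star_step_mul]

theorem step_mul_mul_conjTranspose_apply (g : Fin C.numGates)
    (O : Matrix (C.Basis g.castSucc) (C.Basis g.castSucc) ℂ) (p p' : C.Basis g.succ) :
    (C.step g * O * (C.step g)ᴴ) p p' =
      ∑ b', (∑ b, C.gate g (C.splitOut g p).1 b *
        O (C.glueIn g b p) (C.glueIn g b' p')) * star (C.gate g (C.splitOut g p').1 b') := by
  rw [mul_apply]
  simp only [conjTranspose_apply]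
  rw [sum_mul_star_step]
  refine Finset.sum_congr rfl fun b' _ => ?_
  rw [mul_apply, sum_step_mul]

theorem step_apply_eq_zero {g : Fin C.numGates} {p : C.Basis g.succ} {q : C.Basis g.castSucc}
    {w : W} (h : C.Live g.succ w) (h' : C.Live g.castSucc w) (hpq : p ⟨w, h⟩ ≠ q ⟨w, h'⟩) :
    C.step g p q = 0 := by
  rw [step, of_apply, if_neg]
  exact fun H => hpq (H w h h')

theorem step_update {g : Fin C.numGates} (p : C.Basis g.succ) (q : C.Basis g.castSucc)
    {w : W} (h : C.Live g.succ w) (h' : C.Live g.castSucc w) :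
    C.step g (Function.update p ⟨w, h⟩ (q ⟨w, h'⟩)) q =
      C.step g p (Function.update q ⟨w, h'⟩ (p ⟨w, h⟩)) := by
  have hne : ∀ v (hv : C.Live g.succ v) (a : Fin (C.dim w)), v ≠ w →
      Function.update p ⟨w, h⟩ a ⟨v, hv⟩ = p ⟨v, hv⟩ := fun v hv a hvw =>
    Function.update_of_ne (fun H => hvw (congrArg Subtype.val H)) _ _
  have hne' : ∀ v (hv : C.Live g.castSucc v) (a : Fin (C.dim w)), v ≠ w →
      Function.update q ⟨w, h'⟩ a ⟨v, hv⟩ = q ⟨v, hv⟩ := fun v hv a hvw =>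
    Function.update_of_ne (fun H => hvw (congrArg Subtype.val H)) _ _
  simp only [step, of_apply]
  congr 1
  · refine propext (forall_congr' fun v => ?_)
    by_cases hv : v = w
    · subst hv; simp
    · refine forall₂_congr fun h1 h2 => ?_
      rw [hne v h1 _ hv, hne' v h2 _ hv]
  · congr 1
    · funext v
      exact hne _ _ _ (by rintro H; exact C.not_live_castSucc_of_source v.2 (by rw [H]; exact h'))
    · funext v
      exact (hne' _ _ _ (by
        rintro H; exact C.not_live_succ_of_target v.2 (by rw [H]; exact h))).symm

theorem onFactor_mul_step {g : Fin C.numGates} {w : W} (h : C.Live g.succ w)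
    (h' : C.Live g.castSucc w) (M : Matrix (Fin (C.dim w)) (Fin (C.dim w)) ℂ) :
    onFactor (C.sliceDim g.succ) ⟨w, h⟩ M * C.step g =
      C.step g * onFactor (C.sliceDim g.castSucc) ⟨w, h'⟩ M := by
  ext p q
  rw [onFactor_mul_apply, mul_onFactor_apply, Finset.sum_eq_single (q ⟨w, h'⟩),
    Finset.sum_eq_single (p ⟨w, h⟩), step_update, mul_comm]
  · intro b _ hb
    rw [C.step_apply_eq_zero h h' (by simpa using hb.symm), zero_mul]
  · simp
  · intro a _ ha
    rw [C.step_apply_eq_zero h h' (by simpa using ha), mul_zero]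
  · simp

theorem push_birth_heisenberg (w : W) (M : Matrix (Fin (C.dim w)) (Fin (C.dim w)) ℂ) :
    C.push (C.birth w) (C.heisenberg w M) =
      onFactor (C.sliceDim (C.birth w)) ⟨w, C.live_birth w⟩ M := by
  simp only [push, heisenberg, ← Matrix.mul_assoc]
  rw [evol_mul_conjTranspose, Matrix.one_mul, Matrix.mul_assoc, evol_mul_conjTranspose,
    Matrix.mul_one]

theorem birth_of_source {w : W} {g : Fin C.numGates} (h : C.source w = some g) :
    C.birth w = g.succ := by rw [birth, h]; rfl

theorem birth_le_of_live {t : Fin (C.numGates + 1)} {w : W} (h : C.Live t w) :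
    C.birth w ≤ t := by
  rcases hs : C.source w with _ | g
  · rw [birth, hs]; exact Fin.zero_le _
  · rw [C.birth_of_source hs]; exact h.1 g hs

/-- A wire keeps its Heisenberg representation as long as it is present. -/
theorem push_heisenberg {t : Fin (C.numGates + 1)} {w : W} (h : C.Live t w)
    (M : Matrix (Fin (C.dim w)) (Fin (C.dim w)) ℂ) :
    C.push t (C.heisenberg w M) = onFactor (C.sliceDim t) ⟨w, h⟩ M := by
  have base : ∀ t (h : C.Live t w), C.birth w = t →
      C.push t (C.heisenberg w M) = onFactor (C.sliceDim t) ⟨w, h⟩ M := by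
    rintro _ h rfl
    exact C.push_birth_heisenberg w M
  induction t using Fin.induction with
  | zero => exact base 0 h (le_antisymm (C.birth_le_of_live h) (Fin.zero_le _))
  | succ g ih =>
    by_cases hs : C.source w = some g
    · exact base _ h (C.birth_of_source hs)
    · have h' := C.live_castSucc_of_succ h hs
      rw [push_succ, ih h', ← onFactor_mul_step C h h', Matrix.mul_assoc, step_mul_conjTranspose,
        Matrix.mul_one]

/-- `H` commutes with the Heisenberg representation of every operator on the wire `w`. -/
def Unaffected (H : Matrix (C.Basis 0) (C.Basis 0) ℂ) (w : W) : Prop :=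
  ∀ M, Commute H (C.heisenberg w M)

theorem unaffected_iff {t : Fin (C.numGates + 1)} {w : W} (h : C.Live t w)
    (H : Matrix (C.Basis 0) (C.Basis 0) ℂ) :
    C.Unaffected H w ↔ ActsTriviallyOn (x := C.sliceDim t) (C.push t H) ⟨w, h⟩ := by
  refine ⟨fun hH => .of_commute fun M => ?_, fun hH M => ?_⟩
  · rw [← C.push_heisenberg h, commute_push_iff]; exact hH M
  · rw [← C.commute_push_iff t, C.push_heisenberg h]; exact hH.commute M

theorem unaffected_heisenberg_of_live {t : Fin (C.numGates + 1)} {v w : W} (hv : C.Live t v)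
    (hw : C.Live t w) (hvw : v ≠ w) (M : Matrix (Fin (C.dim v)) (Fin (C.dim v)) ℂ) :
    C.Unaffected (C.heisenberg v M) w := by
  rw [C.unaffected_iff hw, C.push_heisenberg hv]
  exact actsTriviallyOn_onFactor (x := C.sliceDim t) (i := ⟨v, hv⟩) (j := ⟨w, hw⟩)
    (fun h => hvw (congrArg Subtype.val h)) M

/-- An operator that commutes with those on the outputs of a gate commutes with those on its
inputs. -/
theorem unaffected_of_outputs {g : Fin C.numGates} {H : Matrix (C.Basis 0) (C.Basis 0) ℂ}
    (hH : ∀ v, C.source v = some g → C.Unaffected H v) {w : W} (hw : C.target w = some g) :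
    C.Unaffected H w := by
  rw [C.unaffected_iff (C.live_of_target hw), push_castSucc]
  have hT : ∀ v ∈ {v : C.Slice g.succ | C.source v.1 = some g},
      ActsTriviallyOn (x := C.sliceDim g.succ) (C.push g.succ H) v :=
    fun v hv => (C.unaffected_iff v.2 H).1 (hH v.1 hv)
  set O := C.push g.succ H
  -- On the outputs of the gate, `O` is the identity, so the gate cancels against its adjoint.
  obtain ⟨a₀⟩ : Nonempty (∀ w : {w // C.source w = some g}, Fin (C.dim w)) :=
    ⟨fun w => ⟨0, C.dim_pos w⟩⟩
  have hO : ∀ a a' q q', O (C.glueOut g a q) (C.glueOut g a' q') =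
      if a = a' then O (C.glueOut g a₀ q) (C.glueOut g a₀ q') else 0 := by
    intro a a' q q'
    split_ifs with h
    · subst h
      refine apply_eq_of_actsTriviallyOn hT (fun v hv => ?_) (fun v hv => ?_) ?_
      · have hl := C.live_castSucc_of_succ v.2 hv
        rw [C.glueOut_of_live _ _ hl, C.glueOut_of_live _ _ hl]
      · have hl := C.live_castSucc_of_succ v.2 hv
        rw [C.glueOut_of_live _ _ hl, C.glueOut_of_live _ _ hl]
      · refine ⟨fun _ v hv => ?_, fun _ v hv => ?_⟩ <;>
          rw [C.glueOut_of_source _ _ hv, C.glueOut_of_source _ _ hv]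
    · obtain ⟨v, hv⟩ := Function.ne_iff.1 h
      refine (hT ⟨v.1, C.live_of_source v.2⟩ v.2).1 _ _ ?_
      rwa [C.glueOut_of_source _ _ v.2, C.glueOut_of_source _ _ v.2]
  have hconj : ∀ q q', ((C.step g)ᴴ * O * C.step g) q q' =
      if (C.splitIn g q).1 = (C.splitIn g q').1 then O (C.glueOut g a₀ q) (C.glueOut g a₀ q')
      else 0 := by
    intro q q'
    have hG := congrFun (congrFun (C.gate_conjTranspose_mul g) (C.splitIn g q).1)
      (C.splitIn g q').1
    rw [mul_apply, one_apply] at hG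
    rw [conjTranspose_mul_mul_step_apply]
    have hsum : ∀ a', ∑ a, star (C.gate g a (C.splitIn g q).1) *
        O (C.glueOut g a q) (C.glueOut g a' q') =
          star (C.gate g a' (C.splitIn g q).1) * O (C.glueOut g a₀ q) (C.glueOut g a₀ q') := by
      intro a'
      rw [Finset.sum_eq_single a', hO, if_pos rfl]
      · intro a _ ha
        rw [hO, if_neg ha, mul_zero]
      · simp
    simp_rw [hsum]
    calc _ = (∑ a, (C.gate g)ᴴ (C.splitIn g q).1 a * C.gate g a (C.splitIn g q').1) *
          O (C.glueOut g a₀ q) (C.glueOut g a₀ q') := by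
            rw [Finset.sum_mul]
            refine Finset.sum_congr rfl fun a _ => ?_
            rw [conjTranspose_apply]; ring
      _ = _ := by rw [hG]; split_ifs <;> simp
  have hl := C.live_of_target hw
  refine ⟨fun q q' hq => ?_, fun q q' a hq => ?_⟩
  · rw [hconj, if_neg]
    exact fun h => hq (congrFun h ⟨w, hw⟩)
  · have hby : ∀ q : C.Basis g.castSucc,
        (C.splitIn g (Function.update q ⟨w, hl⟩ a)).2 = (C.splitIn g q).2 := by
      intro q
      funext v
      refine Function.update_of_ne (fun h => C.not_live_succ_of_target hw ?_) _ _
      have hv : v.1 = w := congrArg Subtype.val h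
      exact hv ▸ v.2.1
    rw [hconj, hconj, glueOut, glueOut, hby, hby]
    congr 1
    refine propext ⟨fun h => funext fun v => ?_, fun h => funext fun v => ?_⟩
    · by_cases hv : v.1 = w
      · obtain ⟨v, hv'⟩ := v
        obtain rfl : v = w := hv
        exact hq
      · have := congrFun h v
        change Function.update q _ _ _ = Function.update q' _ _ _ at this
        rwa [Function.update_of_ne (fun h => hv (congrArg Subtype.val h)),
          Function.update_of_ne (fun h => hv (congrArg Subtype.val h))] at this
    · change Function.update q _ _ _ = Function.update q' _ _ _
      by_cases hv : v.1 = w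
      · obtain ⟨v, hv'⟩ := v
        obtain rfl : v = w := hv
        simp
      · rw [Function.update_of_ne (fun h => hv (congrArg Subtype.val h)),
          Function.update_of_ne (fun h => hv (congrArg Subtype.val h))]
        exact congrFun h v

/-- Operators on a wire `w` commute with those on a later wire `v` that is not above `w`. -/
theorem unaffected_of_not_below {v w : W} {t : Fin (C.numGates + 1)} (hw : C.Live t w)
    (ht : t ≤ C.birth v) (hne : w ≠ v) (hbelow : ¬ C.Below w v)
    (M : Matrix (Fin (C.dim v)) (Fin (C.dim v)) ℂ) : C.Unaffected (C.heisenberg v M) w := by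
  induction t using Fin.reverseInduction generalizing w with
  | last =>
    have : C.birth v = Fin.last _ := le_antisymm (Fin.le_last _) ht
    exact C.unaffected_heisenberg_of_live (this ▸ C.live_birth v) hw hne.symm M
  | cast g ih =>
    rcases ht.eq_or_lt with heq | hlt
    · exact C.unaffected_heisenberg_of_live (heq ▸ C.live_birth v) hw hne.symm M
    have hle : g.succ ≤ C.birth v := Fin.castSucc_lt_iff_succ_le.1 hlt
    by_cases hg : C.target w = some g
    · refine C.unaffected_of_outputs (fun u hu => ih (C.live_of_source hu) hle ?_ ?_) hg
      · rintro rfl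
        exact hbelow (.single ⟨g, hg, hu⟩)
      · exact fun h => hbelow (.head ⟨g, hg, hu⟩ h)
    · exact ih (C.live_succ_of_castSucc hw hg) hle hne hbelow

end UnitaryCircuit

/-! ### Preference by sets of subsystems -/

section Subsystems

variable {I J : Type*} [Fintype I] [DecidableEq I] [Fintype J] [DecidableEq J]

theorem one_kronecker_onFactor_submatrix (y : J → ℕ) (S : J → Prop) [DecidablePred S] {j : J}
    (hj : S j) (X : Matrix (Fin (y j)) (Fin (y j)) ℂ) :
    ((1 : Matrix (∀ k : {k // ¬ S k}, Fin (y k)) _ ℂ) ⊗ₖ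
      onFactor (fun k : {k // S k} => y k) ⟨j, hj⟩ X).submatrix
        ((Equiv.piEquivPiSubtypeProd S fun k => Fin (y k)).trans (Equiv.prodComm _ _))
        ((Equiv.piEquivPiSubtypeProd S fun k => Fin (y k)).trans (Equiv.prodComm _ _)) =
      onFactor y j X := by
  ext p q
  rw [submatrix_apply, kroneckerMap_apply, onFactor_apply, onFactor_apply, one_apply]
  simp only [Equiv.trans_apply, Equiv.prodComm_apply, Equiv.piEquivPiSubtypeProd_apply,
    Prod.fst_swap, Prod.snd_swap, funext_iff, Subtype.forall, ne_eq, Subtype.mk.injEq]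
  by_cases h : ∀ k, ¬ k = j → p k = q k
  · rw [if_pos h, if_pos (fun k hk => h k fun hkj => hk (hkj ▸ hj)), if_pos (fun k _ => h k),
      one_mul]
  · rw [if_neg h]
    push Not at h
    obtain ⟨k, hkj, hk⟩ := h
    by_cases hS : S k
    · rw [if_neg (c := ∀ k, S k → ¬ k = j → p k = q k) (fun h => hk (h k hS hkj)), mul_zero]
    · rw [if_neg (c := ∀ k, ¬ S k → p k = q k) (fun h => hk (h k hS)), zero_mul]

theorem commute_submatrix_iff {m m' : Type*} [Fintype m] [Fintype m'] (e : m ≃ m')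
    {M N : Matrix m' m' ℂ} : Commute (M.submatrix e e) (N.submatrix e e) ↔ Commute M N := by
  rw [Commute, SemiconjBy, submatrix_mul_equiv, submatrix_mul_equiv]
  exact (reindex (α := ℂ) e.symm e.symm).injective.eq_iff (a := M * N) (b := N * M)

theorem IsPreferredBySystems.commute {x : I → ℕ} {y : J → ℕ}
    {U : Matrix (∀ j, Fin (y j)) (∀ i, Fin (x i)) ℂ} {i : I} {S : J → Prop} [DecidablePred S]
    {P : ProjectiveDecomposition (Fin (x i))} (h : IsPreferredBySystems x y U i S P)
    {p : Matrix (Fin (x i)) (Fin (x i)) ℂ} (hp : p ∈ P.proj) {j : J} (hj : S j)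
    (X : Matrix (Fin (y j)) (Fin (y j)) ℂ) :
    Commute (onFactor x i p) (Uᴴ * onFactor y j X * U) := by
  have := PrefCondOne.commute h.1 hp (onFactor (fun k : {k // S k} => y k) ⟨j, hj⟩ X)
  rw [← commute_submatrix_iff (Equiv.piSplitAt i fun j => Fin (x j)),
    conjTranspose_submatrix] at this
  rw [← one_kronecker_onFactor_submatrix y S hj X]
  refine (congrArg (Commute (onFactor x i p)) ?_).mpr this
  set e := (Equiv.piEquivPiSubtypeProd S fun k => Fin (y k)).trans (Equiv.prodComm _ _)
  generalize (1 : Matrix (∀ k : {k // ¬ S k}, Fin (y k)) (∀ k : {k // ¬ S k}, Fin (y k)) ℂ) ⊗ₖ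
      onFactor (fun k : {k // S k} => y k) ⟨j, hj⟩ X = Y
  have hY : Y = (Y.submatrix e e).submatrix e.symm e.symm := by simp
  nth_rw 2 [hY]
  rw [submatrix_mul_equiv, submatrix_mul_equiv, submatrix_submatrix]
  simp

theorem existsUnique_isPreferredBySystems (x : I → ℕ) (y : J → ℕ)
    (U : Matrix (∀ j, Fin (y j)) (∀ i, Fin (x i)) ℂ) (i : I) (S : J → Prop) [DecidablePred S] :
    ∃! P, IsPreferredBySystems x y U i S P := existsUnique_isPreferredBy _

end Subsystems

namespace UnitaryCircuit

variable {W : Type*} [Fintype W] [DecidableEq W] (C : UnitaryCircuit W)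

theorem heisenberg_eq {t : Fin (C.numGates + 1)} {w : W} (h : C.Live t w)
    (M : Matrix (Fin (C.dim w)) (Fin (C.dim w)) ℂ) :
    C.heisenberg w M = (C.evol t)ᴴ * onFactor (C.sliceDim t) ⟨w, h⟩ M * C.evol t := by
  apply C.push_injective t
  rw [C.push_heisenberg h, push]
  simp only [← Matrix.mul_assoc]
  rw [evol_mul_conjTranspose, Matrix.one_mul, Matrix.mul_assoc, evol_mul_conjTranspose,
    Matrix.mul_one]

/-! ### Comparison of a circuit with its broken circuit -/

variable (B : Finset W)

/-- The segment of a wire in `B` that comes out of the incision. -/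
abbrev outSegment {B : Finset W} (w : B) : Segment B := ⟨(w.1, true), fun _ => w.2⟩

variable {B} {g : Fin C.numGates} {g' : Fin (C.cut B).numGates} {t : Fin (C.numGates + 1)}
  {t' : Fin ((C.cut B).numGates + 1)}

theorem cut_source_iff_cutSource (hg : (g : ℕ) = g') (s : Segment B) :
    (C.cut B).source s = some g' ↔ C.cutSource B s = some g := by
  have : (show Fin C.numGates from g') = g := Fin.ext hg.symm
  rw [← this]; exact Iff.rfl

theorem cut_target_iff_cutTarget (hg : (g : ℕ) = g') (s : Segment B) :
    (C.cut B).target s = some g' ↔ C.cutTarget B s = some g := by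
  have : (show Fin C.numGates from g') = g := Fin.ext hg.symm
  rw [← this]; exact Iff.rfl

theorem cut_source_iff (hg : (g : ℕ) = g') (s : Segment B) :
    (C.cut B).source s = some g' ↔ C.source s.1.1 = some g ∧ s.1.2 = false := by
  rw [C.cut_source_iff_cutSource hg, cutSource]
  cases s.1.2 <;> simp

theorem cut_target_iff (hg : (g : ℕ) = g') (s : Segment B) :
    (C.cut B).target s = some g' ↔ C.target s.1.1 = some g ∧ s.1.2 = decide (s.1.1 ∈ B) := by
  rw [C.cut_target_iff_cutTarget hg, cutTarget]
  obtain ⟨⟨w, i⟩, hs⟩ := s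
  by_cases hw : w ∈ B <;> cases i <;> simp_all

/-- While a wire is present, both of its segments are present in the broken circuit. The stages of
the two circuits are compared by their numbers, because `C.cut B` has as many gates as `C` only by
unfolding of `cut`. -/
theorem live_cut (ht : (t : ℕ) = t') {s : Segment B} (h : C.Live t s.1.1) :
    (C.cut B).Live t' s := by
  refine ⟨fun g' hg => ?_, fun g' hg => ?_⟩
  · have := h.1 ⟨g', g'.2⟩ ((C.cut_source_iff rfl s).1 hg).1
    rw [Fin.le_def] at this ⊢
    exact ht ▸ this
  · have := h.2 ⟨g', g'.2⟩ ((C.cut_target_iff rfl s).1 hg).1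
    rw [Fin.le_def] at this ⊢
    exact ht ▸ this

/-- Basis labels of the circuit, as labels of the broken circuit: of the two segments of a wire `w`
that is present, the one singled out by `σ w` gets the label of `w`. All other segments get the
label `0`; any fixed label would do, since the operators compared are trivial there. -/
def transfer (σ : W → Bool) (t' : Fin ((C.cut B).numGates + 1)) (p : C.Basis t) :
    (C.cut B).Basis t' :=
  fun s => if h : s.1.1.2 = σ s.1.1.1 ∧ C.Live t s.1.1.1 then p ⟨s.1.1.1, h.2⟩
    else ⟨0, C.dim_pos _⟩

variable {C} {σ : W → Bool}

theorem transfer_pos (p : C.Basis t) {s : (C.cut B).Slice t'} (h : s.1.1.2 = σ s.1.1.1)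
    (h' : C.Live t s.1.1.1) : C.transfer σ t' p s = p ⟨s.1.1.1, h'⟩ := dif_pos ⟨h, h'⟩

theorem transfer_neg (p : C.Basis t) {s : (C.cut B).Slice t'}
    (h : ¬ (s.1.1.2 = σ s.1.1.1 ∧ C.Live t s.1.1.1)) :
    C.transfer σ t' p s = ⟨0, C.dim_pos _⟩ := dif_neg h

/-- The matrix elements of `O` are those of `O'` between transferred labels. -/
def IsTransfer (σ : W → Bool) (O : Matrix (C.Basis t) (C.Basis t) ℂ)
    (O' : Matrix ((C.cut B).Basis t') ((C.cut B).Basis t') ℂ) : Prop :=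
  ∀ p p', O p p' = O' (C.transfer σ t' p) (C.transfer σ t' p')

theorem isTransfer_onFactor (ht : (t : ℕ) = t') {k : W} (hk : C.Live t k)
    (hσ : ∀ w, σ w = true → w ∈ B) {i : Bool} (hi : i = σ k) (hB : i = true → k ∈ B)
    (M : Matrix (Fin (C.dim k)) (Fin (C.dim k)) ℂ) :
    IsTransfer σ (onFactor (C.sliceDim t) ⟨k, hk⟩ M)
      (onFactor ((C.cut B).sliceDim t') ⟨⟨(k, i), hB⟩, C.live_cut ht hk⟩ M) := by
  subst hi
  intro p p'
  have hpk : ∀ p : C.Basis t, C.transfer (B := B) σ t' p ⟨⟨(k, σ k), hσ k⟩, C.live_cut ht hk⟩ =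
    p ⟨k, hk⟩ := fun p => transfer_pos p rfl hk
  refine (onFactor_apply _ _ _ _).trans (Eq.trans ?_ (onFactor_apply _ _ _ _).symm)
  refine Eq.trans ?_ (congrArg₂ (fun i j => ite _ (M i j) 0) (hpk p) (hpk p')).symm
  refine ite_congr (propext ⟨fun h s hs => ?_, fun h w hw => ?_⟩) (fun _ => rfl) fun _ => rfl
  · by_cases hsσ : s.1.1.2 = σ s.1.1.1 ∧ C.Live t s.1.1.1
    · rw [transfer_pos p hsσ.1 hsσ.2, transfer_pos p' hsσ.1 hsσ.2]
      refine h _ fun hsk => hs ?_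
      have hsk' : s.1.1.1 = k := congrArg Subtype.val hsk
      refine Subtype.ext (Subtype.ext (Prod.ext hsk' ?_))
      rw [hsσ.1, hsk']
    · rw [transfer_neg p hsσ, transfer_neg p' hsσ]
  · have := h ⟨⟨(w.1, σ w.1), hσ w.1⟩, C.live_cut ht w.2⟩ fun hwk =>
      hw (Subtype.ext (congrArg (fun s => s.1.1.1) hwk))
    rwa [transfer_pos p rfl w.2, transfer_pos p' rfl w.2] at this

theorem transfer_update (ht : (t : ℕ) = t') (p : C.Basis t) {m : W} (hm : C.Live t m)
    (hσ : σ m = true → m ∈ B) (a : Fin (C.dim m)) :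
    C.transfer σ t' (Function.update p ⟨m, hm⟩ a) =
      Function.update (C.transfer σ t' p) ⟨⟨(m, σ m), hσ⟩, C.live_cut ht hm⟩ a := by
  funext s
  by_cases hs : s = ⟨⟨(m, σ m), hσ⟩, C.live_cut ht hm⟩
  · subst hs
    exact ((transfer_pos _ rfl hm).trans (Function.update_self _ _ _)).trans
      (Function.update_self (β := fun s => Fin ((C.cut B).sliceDim t' s))
        ⟨⟨(m, σ m), hσ⟩, C.live_cut ht hm⟩ a _).symm
  · refine Eq.trans ?_ (Function.update_of_ne
      (β := fun s => Fin ((C.cut B).sliceDim t' s)) hs a (C.transfer σ t' p)).symm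
    by_cases hsσ : s.1.1.2 = σ s.1.1.1 ∧ C.Live t s.1.1.1
    · rw [transfer_pos _ hsσ.1 hsσ.2, transfer_pos _ hsσ.1 hsσ.2, Function.update_of_ne]
      intro hsm
      have hsm' : s.1.1.1 = m := congrArg Subtype.val hsm
      refine hs (Subtype.ext (Subtype.ext (Prod.ext hsm' ?_)))
      rw [hsσ.1, hsm']
    · rw [transfer_neg _ hsσ, transfer_neg _ hsσ]

theorem IsTransfer.actsTriviallyOn {O : Matrix (C.Basis t) (C.Basis t) ℂ}
    {O' : Matrix ((C.cut B).Basis t') ((C.cut B).Basis t') ℂ} (h : IsTransfer σ O O')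
    (ht : (t : ℕ) = t') {m : W} (hm : C.Live t m) {i : Bool} (hi : i = σ m)
    (hσ : i = true → m ∈ B)
    (hO' : ActsTriviallyOn (x := (C.cut B).sliceDim t') O' ⟨⟨(m, i), hσ⟩, C.live_cut ht hm⟩) :
    ActsTriviallyOn (x := C.sliceDim t) O ⟨m, hm⟩ := by
  subst hi
  have key : ∀ p : C.Basis t, C.transfer (B := B) σ t' p ⟨⟨(m, σ m), hσ⟩, C.live_cut ht hm⟩ =
    p ⟨m, hm⟩ := fun p => transfer_pos p rfl hm
  refine ⟨fun p q hpq => ?_, fun p q a hpq => ?_⟩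
  · rw [h p q]
    exact hO'.1 _ _ (by rwa [key, key])
  · rw [h, h, transfer_update ht p hm hσ, transfer_update ht q hm hσ]
    exact hO'.2 _ _ a (by rwa [key, key])

variable (C) in
/-- The labels of the broken circuit after a gate that are `a` on the outputs of the gate and `q` on
the bystanders. -/
def cutGlueOut (hg : (g : ℕ) = g') (a : ∀ w : {w // C.source w = some g}, Fin (C.dim w))
    (q : (C.cut B).Basis g'.castSucc) : (C.cut B).Basis g'.succ := fun s =>
  if h : (C.cut B).source s.1 = some g' then a ⟨s.1.1.1, ((C.cut_source_iff hg s.1).1 h).1⟩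
  else q ⟨s.1, (C.cut B).live_castSucc_of_succ s.2 h⟩

variable (C) in
/-- The labels of the broken circuit before a gate that are `b` on the inputs of the gate and `p` on
the bystanders. -/
def cutGlueIn (hg : (g : ℕ) = g') (b : ∀ w : {w // C.target w = some g}, Fin (C.dim w))
    (p : (C.cut B).Basis g'.succ) : (C.cut B).Basis g'.castSucc := fun s =>
  if h : (C.cut B).target s.1 = some g' then b ⟨s.1.1.1, ((C.cut_target_iff hg s.1).1 h).1⟩
  else p ⟨s.1, (C.cut B).live_succ_of_castSucc s.2 h⟩

variable (C) in
theorem cut_source_lower (hg : (g : ℕ) = g') {w : W} (hw : C.source w = some g) :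
    (C.cut B).source (lower B w) = some g' := (C.cut_source_iff hg _).2 ⟨hw, rfl⟩

variable (C) in
theorem cut_target_upper (hg : (g : ℕ) = g') {w : W} (hw : C.target w = some g) :
    (C.cut B).target (upper B w) = some g' := (C.cut_target_iff hg _).2 ⟨hw, rfl⟩

theorem cut_conjTranspose_mul_mul_step_apply (hg : (g : ℕ) = g')
    (O : Matrix ((C.cut B).Basis g'.succ) ((C.cut B).Basis g'.succ) ℂ)
    (q q' : (C.cut B).Basis g'.castSucc) :
    (((C.cut B).step g')ᴴ * O * (C.cut B).step g') q q' =
      ∑ a', (∑ a, star (C.gate g a fun w => q ⟨_, (C.cut B).live_of_target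
          (C.cut_target_upper hg w.2)⟩) *
        O (C.cutGlueOut hg a q) (C.cutGlueOut hg a' q')) *
          C.gate g a' fun w => q' ⟨_, (C.cut B).live_of_target (C.cut_target_upper hg w.2)⟩ := by
  obtain rfl : (show Fin C.numGates from g') = g := Fin.ext hg.symm
  refine ((C.cut B).conjTranspose_mul_mul_step_apply g' O q q').trans ?_
  refine (Fintype.sum_equiv (C.outEquiv B g').symm _ _ fun a' => ?_).symm
  refine congrArg₂ (· * ·) ?_ rfl
  exact Fintype.sum_equiv (C.outEquiv B g').symm _ _ fun a => rfl

theorem cut_step_mul_mul_conjTranspose_apply (hg : (g : ℕ) = g')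
    (O : Matrix ((C.cut B).Basis g'.castSucc) ((C.cut B).Basis g'.castSucc) ℂ)
    (p p' : (C.cut B).Basis g'.succ) :
    ((C.cut B).step g' * O * ((C.cut B).step g')ᴴ) p p' =
      ∑ b', (∑ b, C.gate g (fun w => p ⟨_, (C.cut B).live_of_source
          (C.cut_source_lower hg w.2)⟩) b *
        O (C.cutGlueIn hg b p) (C.cutGlueIn hg b' p')) *
          star (C.gate g (fun w => p' ⟨_, (C.cut B).live_of_source
            (C.cut_source_lower hg w.2)⟩) b') := by
  obtain rfl : (show Fin C.numGates from g') = g := Fin.ext hg.symm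
  refine ((C.cut B).step_mul_mul_conjTranspose_apply g' O p p').trans ?_
  refine (Fintype.sum_equiv (C.inEquiv B g').symm _ _ fun b' => ?_).symm
  refine congrArg₂ (· * ·) ?_ rfl
  exact Fintype.sum_equiv (C.inEquiv B g').symm _ _ fun b => rfl

end UnitaryCircuit

namespace UnitaryCircuit

variable {W : Type*} [Fintype W] [DecidableEq W] {C : UnitaryCircuit W} {B : Finset W}
  {g : Fin C.numGates} {g' : Fin (C.cut B).numGates} {t : Fin (C.numGates + 1)}
  {t' : Fin ((C.cut B).numGates + 1)} {σ : W → Bool}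

theorem cutGlueOut_pos (hg : (g : ℕ) = g') (a q) {s : (C.cut B).Slice g'.succ}
    (h : C.source s.1.1.1 = some g) (h' : s.1.1.2 = false) :
    C.cutGlueOut hg a q s = a ⟨s.1.1.1, h⟩ := dif_pos ((C.cut_source_iff hg s.1).2 ⟨h, h'⟩)

theorem cutGlueOut_neg (hg : (g : ℕ) = g') (a q) {s : (C.cut B).Slice g'.succ}
    (h : ¬ (C.source s.1.1.1 = some g ∧ s.1.1.2 = false)) :
    C.cutGlueOut hg a q s = q ⟨s.1, (C.cut B).live_castSucc_of_succ s.2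
      fun h' => h ((C.cut_source_iff hg s.1).1 h')⟩ :=
  dif_neg fun h' => h ((C.cut_source_iff hg s.1).1 h')

theorem cutGlueIn_pos (hg : (g : ℕ) = g') (b p) {s : (C.cut B).Slice g'.castSucc}
    (h : C.target s.1.1.1 = some g) (h' : s.1.1.2 = decide (s.1.1.1 ∈ B)) :
    C.cutGlueIn hg b p s = b ⟨s.1.1.1, h⟩ := dif_pos ((C.cut_target_iff hg s.1).2 ⟨h, h'⟩)

theorem cutGlueIn_neg (hg : (g : ℕ) = g') (b p) {s : (C.cut B).Slice g'.castSucc}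
    (h : ¬ (C.target s.1.1.1 = some g ∧ s.1.1.2 = decide (s.1.1.1 ∈ B))) :
    C.cutGlueIn hg b p s = p ⟨s.1, (C.cut B).live_succ_of_castSucc s.2
      fun h' => h ((C.cut_target_iff hg s.1).1 h')⟩ :=
  dif_neg fun h' => h ((C.cut_target_iff hg s.1).1 h')

/-- Pulling a transferred operator back through a gate whose inputs are singled out by `σ` as in the
broken circuit. At the outputs, `σ` may single out the segment above the incision where the gate of
the broken circuit feeds the one below it; the operator has to be trivial on both. -/
theorem IsTransfer.pull (hg : (g : ℕ) = g') {O : Matrix (C.Basis g.succ) (C.Basis g.succ) ℂ}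
    {O' : Matrix ((C.cut B).Basis g'.succ) ((C.cut B).Basis g'.succ) ℂ} (h : IsTransfer σ O O')
    (hσ : ∀ w, σ w = true → w ∈ B)
    (hin : ∀ w, C.target w = some g → σ w = decide (w ∈ B))
    (hO' : ∀ s : (C.cut B).Slice g'.succ, C.source s.1.1.1 = some g → σ s.1.1.1 = true →
      ActsTriviallyOn (x := (C.cut B).sliceDim g'.succ) O' s) :
    IsTransfer σ ((C.step g)ᴴ * O * C.step g) (((C.cut B).step g')ᴴ * O' * (C.cut B).step g') := by
  have hts : (g.succ : ℕ) = g'.succ := by simp [hg]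
  set T : Set ((C.cut B).Slice g'.succ) := {s | C.source s.1.1.1 = some g ∧ σ s.1.1.1 = true}
  have hgate : ∀ q : C.Basis g.castSucc, (fun w : {w // C.target w = some g} =>
      C.transfer (B := B) σ g'.castSucc q ⟨upper B w.1, (C.cut B).live_of_target
        (C.cut_target_upper hg w.2)⟩) = (C.splitIn g q).1 :=
    fun q => funext fun w => transfer_pos q (hin w.1 w.2).symm (C.live_of_target w.2)
  have hoff : ∀ a q, ∀ s ∉ T, C.transfer σ g'.succ (C.glueOut g a q) s =
      C.cutGlueOut hg a (C.transfer σ g'.castSucc q) s := by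
    intro a q s hs
    by_cases hsrc : C.source s.1.1.1 = some g
    · have hσs : σ s.1.1.1 = false := by
        simpa using fun h => hs ⟨hsrc, h⟩
      by_cases hb : s.1.1.2 = false
      · rw [cutGlueOut_pos hg _ _ hsrc hb,
          transfer_pos _ (hb.trans hσs.symm) (C.live_of_source hsrc)]
        exact C.glueOut_of_source _ _ hsrc
      · rw [cutGlueOut_neg hg _ _ (fun h => hb h.2), transfer_neg _ (fun h => hb (h.1.trans hσs))]
        exact (transfer_neg _ fun h => C.not_live_castSucc_of_source hsrc h.2).symm
    · rw [cutGlueOut_neg hg _ _ (fun h => hsrc h.1)]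
      by_cases hb : s.1.1.2 = σ s.1.1.1
      · by_cases hl : C.Live g.succ s.1.1.1
        · have hl' := C.live_castSucc_of_succ hl hsrc
          rw [transfer_pos _ hb hl]
          exact (C.glueOut_of_live _ _ hl').trans (transfer_pos _ hb hl').symm
        · rw [transfer_neg _ (fun h => hl h.2)]
          refine (transfer_neg _ fun h => ?_).symm
          by_cases htg : C.target s.1.1.1 = some g
          · exact (C.cut B).not_live_succ_of_target
              ((C.cut_target_iff hg s.1).2 ⟨htg, hb.trans (hin _ htg)⟩) s.2
          · exact hl (C.live_succ_of_castSucc h.2 htg)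
      · rw [transfer_neg _ (fun h => hb h.1)]
        exact (transfer_neg _ fun h => hb h.1).symm
  -- On `T`, both labelings are determined by the labels of the outputs singled out by `σ`.
  have hT₁ : ∀ a a' q q', (∀ s ∈ T, C.transfer σ g'.succ (C.glueOut g a q) s =
      C.transfer σ g'.succ (C.glueOut g a' q') s) ↔
      ∀ w : {w // C.source w = some g}, σ w.1 = true → a w = a' w := by
    intro a a' q q'
    refine ⟨fun h w hw => ?_, fun h s hs => ?_⟩
    · have hl := C.live_of_source w.2
      have := h ⟨⟨(w.1, σ w.1), hσ w.1⟩, C.live_cut hts hl⟩ ⟨w.2, hw⟩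
      rw [transfer_pos _ rfl hl, transfer_pos _ rfl hl] at this
      exact (C.glueOut_of_source _ _ w.2).symm.trans (this.trans (C.glueOut_of_source _ _ w.2))
    · by_cases hb : s.1.1.2 = σ s.1.1.1
      · have hl := C.live_of_source hs.1
        rw [transfer_pos _ hb hl, transfer_pos _ hb hl]
        exact (C.glueOut_of_source _ _ hs.1).trans
          ((h ⟨_, hs.1⟩ hs.2).trans (C.glueOut_of_source a' q' (w := ⟨s.1.1.1, hl⟩) hs.1).symm)
      · rw [transfer_neg _ (fun h => hb h.1), transfer_neg _ (fun h => hb h.1)]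
  have hT₂ : ∀ a a' (q q' : C.Basis g.castSucc),
      (∀ s ∈ T, C.cutGlueOut hg a (C.transfer σ g'.castSucc q) s =
      C.cutGlueOut hg a' (C.transfer σ g'.castSucc q') s) ↔
      ∀ w : {w // C.source w = some g}, σ w.1 = true → a w = a' w := by
    intro a a' q q'
    refine ⟨fun h w hw => ?_, fun h s hs => ?_⟩
    · have := h ⟨lower B w.1, (C.cut B).live_of_source (C.cut_source_lower hg w.2)⟩ ⟨w.2, hw⟩
      rwa [cutGlueOut_pos hg _ _ w.2 rfl, cutGlueOut_pos hg _ _ w.2 rfl] at this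
    · by_cases hb : s.1.1.2 = false
      · rw [cutGlueOut_pos hg _ _ hs.1 hb, cutGlueOut_pos hg _ _ hs.1 hb]
        exact h ⟨_, hs.1⟩ hs.2
      · rw [cutGlueOut_neg hg _ _ (fun h => hb h.2), cutGlueOut_neg hg _ _ (fun h => hb h.2)]
        exact (transfer_neg _ fun h => C.not_live_castSucc_of_source hs.1 h.2).trans
          (transfer_neg _ fun h => C.not_live_castSucc_of_source hs.1 h.2).symm
  intro q q'
  rw [conjTranspose_mul_mul_step_apply, cut_conjTranspose_mul_mul_step_apply hg, hgate, hgate]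
  refine Finset.sum_congr rfl fun a' _ => congrArg₂ _ (Finset.sum_congr rfl fun a _ => ?_) rfl
  rw [h]
  refine congrArg₂ _ rfl (apply_eq_of_actsTriviallyOn (T := T) (fun s hs => hO' s hs.1 hs.2)
    (hoff a q) (hoff a' q') ?_)
  rw [hT₁, hT₂]

/-- Pushing a transferred operator forward through a gate whose outputs are singled out by `σ` as
in the broken circuit. At the inputs, `σ` may single out the segment below the incision where the
gate of the broken circuit takes the one above it; the operator has to be trivial on both. -/
theorem IsTransfer.push (hg : (g : ℕ) = g')
    {O : Matrix (C.Basis g.castSucc) (C.Basis g.castSucc) ℂ}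
    {O' : Matrix ((C.cut B).Basis g'.castSucc) ((C.cut B).Basis g'.castSucc) ℂ}
    (h : IsTransfer σ O O') (hσ : ∀ w, σ w = true → w ∈ B)
    (hout : ∀ w, C.source w = some g → σ w = false)
    (hO' : ∀ s : (C.cut B).Slice g'.castSucc, C.target s.1.1.1 = some g →
      σ s.1.1.1 ≠ decide (s.1.1.1 ∈ B) →
      ActsTriviallyOn (x := (C.cut B).sliceDim g'.castSucc) O' s) :
    IsTransfer σ (C.step g * O * (C.step g)ᴴ) ((C.cut B).step g' * O' * ((C.cut B).step g')ᴴ) := by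
  have hts : (g.castSucc : ℕ) = g'.castSucc := by simp [hg]
  set T : Set ((C.cut B).Slice g'.castSucc) :=
    {s | C.target s.1.1.1 = some g ∧ σ s.1.1.1 ≠ decide (s.1.1.1 ∈ B)}
  have hgate : ∀ p : C.Basis g.succ, (fun w : {w // C.source w = some g} =>
      C.transfer (B := B) σ g'.succ p ⟨lower B w.1, (C.cut B).live_of_source
        (C.cut_source_lower hg w.2)⟩) = (C.splitOut g p).1 :=
    fun p => funext fun w => transfer_pos p (hout w.1 w.2).symm (C.live_of_source w.2)
  have hoff : ∀ b p, ∀ s ∉ T, C.transfer σ g'.castSucc (C.glueIn g b p) s =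
      C.cutGlueIn hg b (C.transfer σ g'.succ p) s := by
    intro b p s hs
    by_cases htg : C.target s.1.1.1 = some g
    · have hσs : σ s.1.1.1 = decide (s.1.1.1 ∈ B) := by
        by_contra h
        exact hs ⟨htg, h⟩
      by_cases hb : s.1.1.2 = decide (s.1.1.1 ∈ B)
      · rw [cutGlueIn_pos hg _ _ htg hb,
          transfer_pos _ (hb.trans hσs.symm) (C.live_of_target htg)]
        exact C.glueIn_of_target _ _ htg
      · rw [cutGlueIn_neg hg _ _ (fun h => hb h.2), transfer_neg _ (fun h => hb (h.1.trans hσs))]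
        exact (transfer_neg _ fun h => C.not_live_succ_of_target htg h.2).symm
    · rw [cutGlueIn_neg hg _ _ (fun h => htg h.1)]
      by_cases hb : s.1.1.2 = σ s.1.1.1
      · by_cases hl : C.Live g.castSucc s.1.1.1
        · have hl' := C.live_succ_of_castSucc hl htg
          rw [transfer_pos _ hb hl]
          exact (C.glueIn_of_live _ _ hl').trans (transfer_pos _ hb hl').symm
        · rw [transfer_neg _ (fun h => hl h.2)]
          refine (transfer_neg _ fun h => ?_).symm
          by_cases hsrc : C.source s.1.1.1 = some g
          · exact (C.cut B).not_live_castSucc_of_source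
              ((C.cut_source_iff hg s.1).2 ⟨hsrc, hb.trans (hout _ hsrc)⟩) s.2
          · exact hl (C.live_castSucc_of_succ h.2 hsrc)
      · rw [transfer_neg _ (fun h => hb h.1)]
        exact (transfer_neg _ fun h => hb h.1).symm
  have hT₁ : ∀ b b' p p', (∀ s ∈ T, C.transfer σ g'.castSucc (C.glueIn g b p) s =
      C.transfer σ g'.castSucc (C.glueIn g b' p') s) ↔
      ∀ w : {w // C.target w = some g}, σ w.1 ≠ decide (w.1 ∈ B) → b w = b' w := by
    intro b b' p p'
    refine ⟨fun h w hw => ?_, fun h s hs => ?_⟩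
    · have hl := C.live_of_target w.2
      have := h ⟨⟨(w.1, σ w.1), hσ w.1⟩, C.live_cut hts hl⟩ ⟨w.2, hw⟩
      rw [transfer_pos _ rfl hl, transfer_pos _ rfl hl] at this
      exact (C.glueIn_of_target _ _ w.2).symm.trans (this.trans (C.glueIn_of_target _ _ w.2))
    · by_cases hb : s.1.1.2 = σ s.1.1.1
      · have hl := C.live_of_target hs.1
        rw [transfer_pos _ hb hl, transfer_pos _ hb hl]
        exact (C.glueIn_of_target _ _ hs.1).trans
          ((h ⟨_, hs.1⟩ hs.2).trans (C.glueIn_of_target b' p' (w := ⟨s.1.1.1, hl⟩) hs.1).symm)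
      · rw [transfer_neg _ (fun h => hb h.1), transfer_neg _ (fun h => hb h.1)]
  have hT₂ : ∀ b b' (p p' : C.Basis g.succ), (∀ s ∈ T, C.cutGlueIn hg b (C.transfer σ g'.succ p) s =
      C.cutGlueIn hg b' (C.transfer σ g'.succ p') s) ↔
      ∀ w : {w // C.target w = some g}, σ w.1 ≠ decide (w.1 ∈ B) → b w = b' w := by
    intro b b' p p'
    refine ⟨fun h w hw => ?_, fun h s hs => ?_⟩
    · have := h ⟨upper B w.1, (C.cut B).live_of_target (C.cut_target_upper hg w.2)⟩ ⟨w.2, hw⟩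
      rwa [cutGlueIn_pos hg _ _ w.2 rfl, cutGlueIn_pos hg _ _ w.2 rfl] at this
    · by_cases hb : s.1.1.2 = decide (s.1.1.1 ∈ B)
      · rw [cutGlueIn_pos hg _ _ hs.1 hb, cutGlueIn_pos hg _ _ hs.1 hb]
        exact h ⟨_, hs.1⟩ hs.2
      · rw [cutGlueIn_neg hg _ _ (fun h => hb h.2), cutGlueIn_neg hg _ _ (fun h => hb h.2)]
        exact (transfer_neg _ fun h => C.not_live_succ_of_target hs.1 h.2).trans
          (transfer_neg _ fun h => C.not_live_succ_of_target hs.1 h.2).symm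
  intro p p'
  rw [step_mul_mul_conjTranspose_apply, cut_step_mul_mul_conjTranspose_apply hg, hgate, hgate]
  refine Finset.sum_congr rfl fun b' _ => congrArg₂ _ (Finset.sum_congr rfl fun b _ => ?_) rfl
  rw [h]
  refine congrArg₂ _ rfl (apply_eq_of_actsTriviallyOn (T := T) (fun s hs => hO' s hs.1 hs.2)
    (hoff b p) (hoff b' p') ?_)
  rw [hT₁, hT₂]

end UnitaryCircuit

/-! ### Commutation of preferred projectors in the original circuit -/

/-- The instances with respect to which preference is expressed do not matter. In the definition of
the preferred set, some of them are found classically. -/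
theorem IsPreferredBySystems.of_instances {I J : Type*} {fI fI' : Fintype I}
    {dI dI' : DecidableEq I} {fJ fJ' : Fintype J} {dJ dJ' : DecidableEq J} {x : I → ℕ} {y : J → ℕ}
    {U : Matrix (∀ j, Fin (y j)) (∀ i, Fin (x i)) ℂ} {i : I} {S : J → Prop}
    {dS dS' : DecidablePred S} {P : ProjectiveDecomposition (Fin (x i))}
    (h : @IsPreferredBySystems I J fI dI fJ dJ x y U i S dS P) :
    @IsPreferredBySystems I J fI' dI' fJ' dJ' x y U i S dS' P := by
  convert h

namespace UnitaryCircuit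

variable {W : Type*} [Fintype W] [DecidableEq W] (C : UnitaryCircuit W) {B : Finset W}

/-- An operator on `A^in` that commutes, in the broken circuit, with all operators on the segments
that come out of the incisions, commutes in the original circuit with all operators on the other
wires in the bubble that are present at some stage before `A` or together with `A`. -/
theorem unaffected_of_ingoing {k : W} (hk : k ∈ B)
    {P : Matrix (Fin (C.dim k)) (Fin (C.dim k)) ℂ}
    (h : ∀ m : B, (C.cut B).Unaffected ((C.cut B).heisenberg (lower B k) P) (outSegment m))
    {m : W} (hmB : m ∈ B) (hmk : m ≠ k) {t : Fin (C.numGates + 1)} (ht : t ≤ C.birth k)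
    (hm : C.Live t m) : C.Unaffected (C.heisenberg k P) m := by
  -- Going back, a wire is met above its incision, except for `k`, where the
  -- operator starts below it.
  set σ : W → Bool := fun w => decide (w ∈ B ∧ w ≠ k) with hσdef
  have hσ : ∀ w, σ w = true → w ∈ B := fun w hw => (of_decide_eq_true hw).1
  have hσk : false = σ k := by simp [hσdef]
  have key : ∀ t ≤ C.birth k, ∀ t' : Fin ((C.cut B).numGates + 1), (t : ℕ) = t' →
      IsTransfer σ (C.push t (C.heisenberg k P))
        ((C.cut B).push t' ((C.cut B).heisenberg (lower B k) P)) := by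
    have base : ∀ t, C.birth k = t → ∀ t' : Fin ((C.cut B).numGates + 1), (t : ℕ) = t' →
        IsTransfer σ (C.push t (C.heisenberg k P))
          ((C.cut B).push t' ((C.cut B).heisenberg (lower B k) P)) := by
      rintro _ rfl t' ht
      rw [C.push_heisenberg (C.live_birth k)]
      have := (C.cut B).push_heisenberg (t := t') (w := lower B k)
        (C.live_cut ht (s := lower B k) (C.live_birth k)) P
      rw [this]
      exact isTransfer_onFactor ht (C.live_birth k) hσ hσk (by simp) P
    intro t ht
    induction t using Fin.reverseInduction with
    | last => exact base _ (le_antisymm (Fin.le_last _) ht)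
    | cast g ih =>
      rcases ht.eq_or_lt with heq | hlt
      · exact base _ heq.symm
      have hle : g.succ ≤ C.birth k := Fin.castSucc_lt_iff_succ_le.1 hlt
      intro t' htt
      obtain ⟨g', rfl⟩ : ∃ g' : Fin (C.cut B).numGates, t' = g'.castSucc :=
        ⟨⟨g, g.2⟩, Fin.ext htt.symm⟩
      have hg : (g : ℕ) = g' := htt
      have ih' := ih hle g'.succ (by simp [hg])
      rw [push_castSucc, push_castSucc]
      refine ih'.pull hg hσ (fun w hw => ?_) fun s hs hsσ => ?_
      · have hwk : w ≠ k := by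
          rintro rfl
          exact absurd (hle.trans (C.birth_le_of_live (C.live_of_target hw))) (by simp [Fin.le_def])
        simp [hσdef, hwk]
      · obtain ⟨hsB, hsk⟩ := of_decide_eq_true hsσ
        refine ((C.cut B).unaffected_iff s.2 _).1 ?_
        obtain ⟨⟨⟨w, i⟩, hw⟩, hl⟩ := s
        cases i
        · -- The segments that go into the incisions are all present at the end.
          exact (C.cut B).unaffected_heisenberg_of_live (C.cutIn B ⟨k, hk⟩).2 (C.cutIn B ⟨w, hsB⟩).2
            (fun h => hsk (congrArg (fun s => s.1.1) h).symm) P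
        · exact h ⟨w, hsB⟩
  have hσm : true = σ m := by simp [hσdef, hmB, hmk]
  rw [C.unaffected_iff hm]
  refine (key t ht t rfl).actsTriviallyOn rfl hm hσm (fun _ => hmB) ?_
  exact ((C.cut B).unaffected_iff (t := t) (w := outSegment ⟨m, hmB⟩)
    (C.live_cut rfl (s := outSegment ⟨m, hmB⟩) hm) _).1 (h ⟨m, hmB⟩)

/-- An operator on `A^out` that commutes, in the broken circuit, with all operators on the segments
that go into the incisions, commutes in the original circuit with all operators on the other
wires in the bubble that are present at some stage after `A` or together with `A`. -/
theorem unaffected_of_outgoing {j : W} (hj : j ∈ B)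
    {Q : Matrix (Fin (C.dim j)) (Fin (C.dim j)) ℂ}
    (h : ∀ m : B, (C.cut B).Unaffected ((C.cut B).heisenberg (outSegment ⟨j, hj⟩) Q) (lower B m))
    {m : W} (hmB : m ∈ B) (hmj : m ≠ j) {t : Fin (C.numGates + 1)} (ht : C.birth j ≤ t)
    (hm : C.Live t m) : C.Unaffected (C.heisenberg j Q) m := by
  -- Going forward, a wire is met below its incision, except for `j`, where the
  -- operator starts above it.
  set σ : W → Bool := fun w => decide (w = j) with hσdef
  have hσ : ∀ w, σ w = true → w ∈ B := fun w hw => (of_decide_eq_true hw) ▸ hj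
  have hσj : true = σ j := by simp [hσdef]
  have key : ∀ t, C.birth j ≤ t → ∀ t' : Fin ((C.cut B).numGates + 1), (t : ℕ) = t' →
      IsTransfer σ (C.push t (C.heisenberg j Q))
        ((C.cut B).push t' ((C.cut B).heisenberg (outSegment ⟨j, hj⟩) Q)) := by
    have base : ∀ t, C.birth j = t → ∀ t' : Fin ((C.cut B).numGates + 1), (t : ℕ) = t' →
        IsTransfer σ (C.push t (C.heisenberg j Q))
          ((C.cut B).push t' ((C.cut B).heisenberg (outSegment ⟨j, hj⟩) Q)) := by
      rintro _ rfl t' ht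
      rw [C.push_heisenberg (C.live_birth j)]
      have := (C.cut B).push_heisenberg (t := t') (w := outSegment ⟨j, hj⟩)
        (C.live_cut ht (s := outSegment ⟨j, hj⟩) (C.live_birth j)) Q
      rw [this]
      exact isTransfer_onFactor ht (C.live_birth j) hσ hσj (fun _ => hj) Q
    intro t ht
    induction t using Fin.induction with
    | zero => exact base _ (le_antisymm ht (Fin.zero_le _))
    | succ g ih =>
      rcases ht.eq_or_lt with heq | hlt
      · exact base _ heq
      have hle : C.birth j ≤ g.castSucc := Fin.le_castSucc_iff.2 hlt
      intro t' htt
      obtain ⟨g', rfl⟩ : ∃ g' : Fin (C.cut B).numGates, t' = g'.succ :=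
        ⟨⟨g, g.2⟩, Fin.ext htt.symm⟩
      have hg : (g : ℕ) = g' := Nat.succ.inj htt
      have ih' := ih hle g'.castSucc hg
      rw [push_succ, push_succ]
      refine ih'.push hg hσ (fun w hw => ?_) fun s hs hsσ => ?_
      · have hwj : w ≠ j := by
          rintro rfl
          rw [C.birth_of_source hw] at hle
          exact absurd hle (by simp [Fin.le_def])
        simp [hσdef, hwj]
      · refine ((C.cut B).unaffected_iff s.2 _).1 ?_
        obtain ⟨⟨⟨w, i⟩, hw⟩, hl⟩ := s
        have hwj : w ≠ j := by
          rintro rfl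
          exact hsσ (by simp [hσdef, hj])
        have hwB : w ∈ B := by
          by_contra hwB
          exact hsσ (by simp [hσdef, hwj, hwB])
        cases i
        · exact h ⟨w, hwB⟩
        · -- The segments that come out of the incisions are all present at the beginning.
          exact (C.cut B).unaffected_heisenberg_of_live (C.cutOut B ⟨j, hj⟩).2
            (C.cutOut B ⟨w, hwB⟩).2 (fun h => hwj (congrArg (fun s => s.1.1) h).symm) Q
  have hσm : false = σ m := by simp [hσdef, hmj]
  rw [C.unaffected_iff hm]
  refine (key t ht t rfl).actsTriviallyOn rfl hm hσm (by simp) ?_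
  exact ((C.cut B).unaffected_iff (t := t) (w := lower B m)
    (C.live_cut rfl (s := lower B m) hm) _).1 (h ⟨m, hmB⟩)

/-- A projector on an input wire preferred by a set of output wires commutes with all operators on
these. -/
theorem unaffected_of_isPreferredBySystems_total {v w : W} (hv : C.Live (Fin.last C.numGates) v)
    (hw : C.Live 0 w) {S : C.Slice (Fin.last C.numGates) → Prop} [DecidablePred S]
    {P : ProjectiveDecomposition (Fin (C.dim w))}
    (hP : IsPreferredBySystems (C.sliceDim 0) (C.sliceDim (Fin.last C.numGates)) C.total
      ⟨w, hw⟩ S P)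
    {p : Matrix (Fin (C.dim w)) (Fin (C.dim w)) ℂ} (hp : p ∈ P.proj) (hS : S ⟨v, hv⟩) :
    C.Unaffected (C.heisenberg w p) v := by
  intro X
  rw [C.heisenberg_eq hv, C.heisenberg_eq hw, evol_zero, conjTranspose_one, Matrix.one_mul,
    Matrix.mul_one]
  exact hP.commute hp hS X

/-- A projector on an output wire preferred by a set of input wires commutes with all operators on
these. -/
theorem unaffected_of_isPreferredBySystems_total_conjTranspose {v w : W} (hv : C.Live 0 v)
    (hw : C.Live (Fin.last C.numGates) w) {S : C.Slice 0 → Prop} [DecidablePred S]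
    {P : ProjectiveDecomposition (Fin (C.dim w))}
    (hP : IsPreferredBySystems (C.sliceDim (Fin.last C.numGates)) (C.sliceDim 0) C.totalᴴ
      ⟨w, hw⟩ S P)
    {p : Matrix (Fin (C.dim w)) (Fin (C.dim w)) ℂ} (hp : p ∈ P.proj) (hS : S ⟨v, hv⟩) :
    C.Unaffected (C.heisenberg w p) v := by
  intro X
  have h := hP.commute hp hS X
  rw [conjTranspose_conjTranspose] at h
  rw [← C.commute_push_iff (Fin.last _), C.push_heisenberg hw, C.heisenberg_eq hv, evol_zero,
    conjTranspose_one, Matrix.one_mul, Matrix.mul_one]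
  exact h

variable {C} in
theorem IsPreferredSet.unaffected_ingoing {D : C.BubbleDecompositions B}
    (hD : C.IsPreferredSet B D) (w : B) {p : Matrix (Fin (C.dim w)) (Fin (C.dim w)) ℂ}
    (hp : p ∈ (D.ingoing w).proj) (v : B) :
    (C.cut B).Unaffected ((C.cut B).heisenberg (lower B w.1) p) (outSegment v) := by
  classical
  have h : IsPreferredBySystems ((C.cut B).sliceDim (Fin.last (C.cut B).numGates))
      ((C.cut B).sliceDim 0) (C.cut B).totalᴴ (C.cutIn B w)
      (fun s => ∃ v : B, s = C.cutOut B v) (D.ingoing w) := by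
    exact .of_instances (hD w).2
  exact (C.cut B).unaffected_of_isPreferredBySystems_total_conjTranspose (C.cutOut B v).2
    (C.cutIn B w).2 (S := fun s => ∃ v : B, s = C.cutOut B v) h hp ⟨v, rfl⟩

variable {C} in
theorem IsPreferredSet.unaffected_outgoing {D : C.BubbleDecompositions B}
    (hD : C.IsPreferredSet B D) (w : B) {p : Matrix (Fin (C.dim w)) (Fin (C.dim w)) ℂ}
    (hp : p ∈ (D.outgoing w).proj) (v : B) :
    (C.cut B).Unaffected ((C.cut B).heisenberg (outSegment w) p) (lower B v.1) := by
  classical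
  have h : IsPreferredBySystems ((C.cut B).sliceDim 0)
      ((C.cut B).sliceDim (Fin.last (C.cut B).numGates)) (C.cut B).total (C.cutOut B w)
      (fun s => ∃ v : B, s = C.cutIn B v) (D.outgoing w) := by
    exact .of_instances (hD w).1
  exact (C.cut B).unaffected_of_isPreferredBySystems_total (C.cutIn B v).2
    (C.cutOut B w).2 (S := fun s => ∃ v : B, s = C.cutIn B v) h hp ⟨v, rfl⟩

variable {C} in
/-- Ingoing preferred projectors commute with all operators on earlier wires of the bubble. -/
theorem IsPreferredSet.commute_ingoing {D : C.BubbleDecompositions B}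
    (hD : C.IsPreferredSet B D) {j k : B} (hjk : j ≠ k) (hbelow : ¬ C.Below k j)
    {p : Matrix (Fin (C.dim k)) (Fin (C.dim k)) ℂ} (hp : p ∈ (D.ingoing k).proj)
    (X : Matrix (Fin (C.dim j)) (Fin (C.dim j)) ℂ) :
    Commute (C.heisenberg j X) (C.heisenberg k p) := by
  have hne : (j : W) ≠ k := fun h => hjk (Subtype.ext h)
  rcases lt_or_ge (C.birth k) (C.birth j) with hlt | hle
  · exact C.unaffected_of_not_below (C.live_birth k) hlt.le hne.symm hbelow X p
  · exact (C.unaffected_of_ingoing k.2 (hD.unaffected_ingoing k hp) j.2 hne hle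
      (C.live_birth j) X).symm

variable {C} in
/-- Outgoing preferred projectors commute with all operators on later wires of the bubble. -/
theorem IsPreferredSet.commute_outgoing {D : C.BubbleDecompositions B}
    (hD : C.IsPreferredSet B D) {j k : B} (hjk : j ≠ k) (hbelow : ¬ C.Below k j)
    {q : Matrix (Fin (C.dim j)) (Fin (C.dim j)) ℂ} (hq : q ∈ (D.outgoing j).proj)
    (X : Matrix (Fin (C.dim k)) (Fin (C.dim k)) ℂ) :
    Commute (C.heisenberg j q) (C.heisenberg k X) := by
  have hne : (j : W) ≠ k := fun h => hjk (Subtype.ext h)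
  rcases lt_or_ge (C.birth k) (C.birth j) with hlt | hle
  · exact C.unaffected_of_not_below (C.live_birth k) hlt.le hne.symm hbelow q X
  · exact C.unaffected_of_outgoing j.2 (hD.unaffected_outgoing j hq) k.2 hne.symm hle
      (C.live_birth k) X

variable {C} in
theorem existsUnique_isPreferredSet : ∃! D : C.BubbleDecompositions B, C.IsPreferredSet B D := by
  classical
  choose P hP hPu using fun w : B => existsUnique_isPreferredBySystems ((C.cut B).sliceDim 0)
    ((C.cut B).sliceDim (Fin.last C.numGates)) (C.cut B).total (C.cutOut B w)
    (fun s => ∃ v : B, s = C.cutIn B v)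
  choose Q hQ hQu using fun w : B => existsUnique_isPreferredBySystems
    ((C.cut B).sliceDim (Fin.last C.numGates)) ((C.cut B).sliceDim 0) (C.cut B).totalᴴ
    (C.cutIn B w) (fun s => ∃ v : B, s = C.cutOut B v)
  refine ⟨⟨Q, P⟩, fun w => ⟨?_, ?_⟩, fun D hD => ?_⟩
  · convert hP w
  · convert hQ w
  · refine BubbleDecompositions.ext (funext fun w => hQu w _ ?_) (funext fun w => hPu w _ ?_)
    · convert (hD w).2
    · convert (hD w).1

end UnitaryCircuit

/-! ### Consistent histories from commutation relations -/

section Histories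

variable {s : Type*} [Fintype s] [DecidableEq s] {n : ℕ}

theorem interleave_zero {α : Type*} (a b : Fin n → α) (k : Fin n) :
    interleave a b (finProdFinEquiv (k, 0)) = a k := by
  have h : (Fin.divNat (finProdFinEquiv (k, (0 : Fin 2))), Fin.modNat (finProdFinEquiv (k, 0))) =
    (k, 0) := finProdFinEquiv.symm_apply_apply (k, 0)
  rw [Prod.mk.injEq] at h
  rw [interleave, if_pos h.2, h.1]

theorem interleave_one {α : Type*} (a b : Fin n → α) (k : Fin n) :
    interleave a b (finProdFinEquiv (k, 1)) = b k := by
  have h : (Fin.divNat (finProdFinEquiv (k, (1 : Fin 2))), Fin.modNat (finProdFinEquiv (k, 1))) =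
    (k, 1) := finProdFinEquiv.symm_apply_apply (k, 1)
  rw [Prod.mk.injEq] at h
  rw [interleave, if_neg (by rw [h.2]; exact one_ne_zero), h.1]

theorem forall_fin_mul_two {p : Fin (n * 2) → Prop} :
    (∀ j, p j) ↔ ∀ k : Fin n, p (finProdFinEquiv (k, 0)) ∧ p (finProdFinEquiv (k, 1)) := by
  refine ⟨fun h k => ⟨h _, h _⟩, fun h j => ?_⟩
  obtain ⟨⟨k, i⟩, rfl⟩ := finProdFinEquiv.surjective j
  fin_cases i
  exacts [(h k).1, (h k).2]

theorem prod_ofFn_mul_two {M : Type*} [Monoid M] (X : Fin (n * 2) → M) :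
    (List.ofFn X).prod =
      (List.ofFn fun k => X (finProdFinEquiv (k, 0)) * X (finProdFinEquiv (k, 1))).prod := by
  rw [List.ofFn_mul, List.prod_flatten, List.map_ofFn]
  congr 2
  funext k
  simp only [Function.comp_apply, List.ofFn_succ, List.ofFn_zero, List.prod_cons, List.prod_nil,
    mul_one]
  congr 2 <;> exact Fin.ext (by simp [finProdFinEquiv]; try ring)

theorem commute_prod_ofFn {M : Type*} [Monoid M] {n : ℕ} {x : M} {a : Fin n → M}
    (h : ∀ k, Commute x (a k)) : Commute x (List.ofFn a).prod :=
  Commute.list_prod_right _ _ fun y hy => by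
    obtain ⟨k, rfl⟩ := (List.mem_ofFn' _ _).1 hy
    exact h k

theorem prod_ofFn_mul {M : Type*} [Monoid M] {n : ℕ} {a b : Fin n → M}
    (h : ∀ j k, j < k → Commute (b j) (a k)) :
    (List.ofFn fun k => a k * b k).prod = (List.ofFn a).prod * (List.ofFn b).prod := by
  induction n with
  | zero => simp
  | succ n ih =>
    simp only [List.ofFn_succ, List.prod_cons]
    rw [ih fun j k hjk => h _ _ (Fin.succ_lt_succ_iff.2 hjk)]
    have := commute_prod_ofFn (x := b 0) (a := fun k => a (Fin.succ k))
      fun k => h _ _ (Fin.succ_pos k)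
    rw [mul_assoc, ← mul_assoc (b 0), this.eq]
    simp only [mul_assoc]

theorem isStarProjection_prod_ofFn {R : Type*} [Semiring R] [StarRing R] {n : ℕ} {a : Fin n → R}
    (ha : ∀ k, IsStarProjection (a k)) (h : ∀ j k, j < k → Commute (a j) (a k)) :
    IsStarProjection (List.ofFn a).prod := by
  induction n with
  | zero => simp
  | succ n ih =>
    rw [List.ofFn_succ, List.prod_cons]
    exact (ha 0).mul (ih (fun k => ha k.succ) fun j k hjk => h _ _ (Fin.succ_lt_succ_iff.2 hjk))
      (commute_prod_ofFn fun k => h _ _ (Fin.succ_pos k))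

theorem star_prod_of_isSelfAdjoint {R : Type*} [Semiring R] [StarRing R] (l : List R)
    (h : ∀ x ∈ l, star x = x) : l.reverse.prod = star l.prod := by
  induction l with
  | nil => simp
  | cons x l ih =>
    rw [List.reverse_cons, List.prod_append, List.prod_singleton, List.prod_cons, star_mul,
      h x List.mem_cons_self, ih fun y hy => h y (List.mem_cons_of_mem _ hy)]

theorem historyProb_smul_one {N : ℕ} (c : ℂ) {X : Fin N → Matrix s s ℂ}
    (hX : ∀ k, IsStarProjection (X k)) :
    historyProb (c • 1) X = c * trace ((List.ofFn X).prodᴴ * (List.ofFn X).prod) := by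
  rw [historyProb, star_prod_of_isSelfAdjoint, mul_smul_comm, mul_one, smul_mul_assoc, trace_smul,
    smul_eq_mul, star_eq_conjTranspose]
  intro x hx
  obtain ⟨k, rfl⟩ := (List.mem_ofFn' _ _).1 hx
  exact (hX k).isSelfAdjoint

/-- The commutation relations between ingoing projectors (at even places) and outgoing projectors
(at odd places) that turn every history operator into a product of two projectors. -/
structure HistoryCommute (D : Fin (n * 2) → Finset (Matrix s s ℂ)) : Prop where
  ingoing : ∀ j k : Fin n, j < k → ∀ P ∈ D (finProdFinEquiv (j, 0)),
    ∀ Q ∈ D (finProdFinEquiv (k, 0)), Commute P Q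
  outgoing : ∀ j k : Fin n, j < k → ∀ P ∈ D (finProdFinEquiv (j, 1)),
    ∀ Q ∈ D (finProdFinEquiv (k, 1)), Commute P Q
  mixed : ∀ j k : Fin n, j < k → ∀ P ∈ D (finProdFinEquiv (j, 1)),
    ∀ Q ∈ D (finProdFinEquiv (k, 0)), Commute P Q

omit [DecidableEq s] in
theorem commute_sum {S T : Finset (Matrix s s ℂ)} (h : ∀ P ∈ S, ∀ Q ∈ T, Commute P Q) :
    Commute (∑ P ∈ S, P) (∑ Q ∈ T, Q) :=
  Commute.sum_left _ _ _ fun P hP => Commute.sum_right _ _ _ fun Q hQ => h P hP Q hQ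

omit [DecidableEq s] in
theorem HistoryCommute.sum {D S : Fin (n * 2) → Finset (Matrix s s ℂ)} (h : HistoryCommute D)
    (hS : ∀ k, S k ⊆ D k) : HistoryCommute fun k => {∑ P ∈ S k, P} := by
  refine ⟨fun j k hjk P hP Q hQ => ?_, fun j k hjk P hP Q hQ => ?_, fun j k hjk P hP Q hQ => ?_⟩ <;>
    rw [Finset.mem_singleton.1 hP, Finset.mem_singleton.1 hQ] <;>
    refine commute_sum fun P hP Q hQ => ?_
  exacts [h.ingoing j k hjk P (hS _ hP) Q (hS _ hQ), h.outgoing j k hjk P (hS _ hP) Q (hS _ hQ),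
    h.mixed j k hjk P (hS _ hP) Q (hS _ hQ)]

/-- If `E` is the product of the ingoing and `F` that of the outgoing projectors, the history
operator is `E F`, and `Tr (F E E F) = Tr (E F)`. -/
theorem historyProb_eq_trace (c : ℂ) {X : Fin (n * 2) → Matrix s s ℂ}
    (hX : ∀ k, IsStarProjection (X k)) {D : Fin (n * 2) → Finset (Matrix s s ℂ)}
    (h : HistoryCommute D) (hD : ∀ k, X k ∈ D k) :
    historyProb (c • 1) X = c * trace (List.ofFn X).prod := by
  rw [historyProb_smul_one c hX, prod_ofFn_mul_two,
    prod_ofFn_mul fun j k hjk => h.mixed j k hjk _ (hD _) _ (hD _)]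
  have hE := isStarProjection_prod_ofFn (fun k => hX (finProdFinEquiv (k, 0)))
    fun j k hjk => h.ingoing j k hjk _ (hD _) _ (hD _)
  have hF := isStarProjection_prod_ofFn (fun k => hX (finProdFinEquiv (k, 1)))
    fun j k hjk => h.outgoing j k hjk _ (hD _) _ (hD _)
  set E := (List.ofFn fun k : Fin n => X (finProdFinEquiv (k, 0))).prod
  set F := (List.ofFn fun k : Fin n => X (finProdFinEquiv (k, 1))).prod
  have hEE : E * E = E := hE.isIdempotentElem
  have hFF : F * F = F := hF.isIdempotentElem
  have hE' : Eᴴ = E := hE.isSelfAdjoint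
  have hF' : Fᴴ = F := hF.isSelfAdjoint
  rw [conjTranspose_mul, hE', hF', mul_assoc, ← mul_assoc E, hEE, trace_mul_comm, mul_assoc, hFF]

theorem prod_ofFn_sum {N : ℕ} (S : Fin N → Finset (Matrix s s ℂ)) :
    (List.ofFn fun k => ∑ P ∈ S k, P).prod = ∑ h ∈ Fintype.piFinset S, (List.ofFn h).prod := by
  have := (MultilinearMap.mkPiAlgebraFin ℂ N (Matrix s s ℂ)).map_sum_finset (fun _ P => P) S
  simpa only [MultilinearMap.mkPiAlgebraFin_apply] using this

omit [DecidableEq s] in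
theorem isStarProjection_sum {S : Finset (Matrix s s ℂ)} (h : ∀ P ∈ S, IsStarProjection P)
    (h' : ∀ P ∈ S, ∀ Q ∈ S, P ≠ Q → P * Q = 0) : IsStarProjection (∑ P ∈ S, P) := by
  refine ⟨?_, ?_⟩
  · rw [IsIdempotentElem, Finset.sum_mul_sum]
    refine Finset.sum_congr rfl fun P hP => ?_
    rw [Finset.sum_eq_single P (fun Q hQ hne => h' P hP Q hQ hne.symm) (absurd hP)]
    exact (h P hP).isIdempotentElem
  · rw [IsSelfAdjoint, star_sum]
    exact Finset.sum_congr rfl fun P hP => (h P hP).isSelfAdjoint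

open ComplexOrder in
theorem historyProb_nonneg {N : ℕ} {c : ℂ} (hc : 0 ≤ c) {X : Fin N → Matrix s s ℂ}
    (hX : ∀ k, IsStarProjection (X k)) :
    (historyProb (c • 1) X).im = 0 ∧ 0 ≤ (historyProb (c • 1) X).re := by
  have h : 0 ≤ historyProb (c • 1) X := by
    rw [historyProb_smul_one c hX]
    exact mul_nonneg hc (posSemidef_conjTranspose_mul_self _).trace_nonneg
  rw [Complex.nonneg_iff] at h
  exact ⟨h.2.symm, h.1⟩

open ComplexOrder in
/-- On sums of projectors the probability of a history is `Tr` of a product, hence multilinear. -/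
theorem HistoryCommute.isConsistent {D : Fin (n * 2) → Finset (Matrix s s ℂ)}
    (h : HistoryCommute D) {d : ℕ} (hd : Fintype.card s = d) (hd0 : d ≠ 0)
    (hD : ∀ k, ∀ P ∈ D k, IsStarProjection P)
    (hD' : ∀ k, ∀ P ∈ D k, ∀ Q ∈ D k, P ≠ Q → P * Q = 0) (hsum : ∀ k, ∑ P ∈ D k, P = 1) :
    IsConsistent ((d : ℂ)⁻¹ • 1) D := by
  have hlin : ∀ S : Fin (n * 2) → Finset (Matrix s s ℂ), (∀ k, S k ⊆ D k) →
      historyProb ((d : ℂ)⁻¹ • 1) (fun k => ∑ P ∈ S k, P) =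
        ∑ x ∈ Fintype.piFinset S, historyProb ((d : ℂ)⁻¹ • 1) x := by
    intro S hS
    rw [historyProb_eq_trace _ (fun k => isStarProjection_sum (fun P hP => hD k P (hS k hP))
      fun P hP Q hQ => hD' k P (hS k hP) Q (hS k hQ)) (h.sum hS) fun k =>
        Finset.mem_singleton_self _, prod_ofFn_sum, trace_sum, Finset.mul_sum]
    refine Finset.sum_congr rfl fun x hx => ?_
    have hxD : ∀ k, x k ∈ D k := fun k => hS k (Fintype.mem_piFinset.1 hx k)
    rw [historyProb_eq_trace _ (fun k => hD k _ (hxD k)) h hxD]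
  refine ⟨fun x hx => historyProb_nonneg (by positivity)
    fun k => hD k _ (Fintype.mem_piFinset.1 hx k), ?_, hlin⟩
  rw [← hlin D fun k => Finset.Subset.refl _]
  simp only [hsum]
  rw [historyProb_smul_one _ fun _ => .one _]
  simp [hd, hd0]

end Histories

/-! ### Heisenberg projectors of the preferred set -/

namespace UnitaryCircuit

variable {W : Type*} [Fintype W] [DecidableEq W] (C : UnitaryCircuit W)

theorem heisenberg_mul (w : W) (M N : Matrix (Fin (C.dim w)) (Fin (C.dim w)) ℂ) :
    C.heisenberg w (M * N) = C.heisenberg w M * C.heisenberg w N := by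
  apply C.push_injective (C.birth w)
  simp only [push_mul, push_birth_heisenberg]
  exact onFactor_mul (x := C.sliceDim (C.birth w)) ⟨w, C.live_birth w⟩ M N

theorem heisenberg_one (w : W) : C.heisenberg w 1 = 1 := by
  have h : onFactor (C.sliceDim (C.birth w)) ⟨w, C.live_birth w⟩ 1 = 1 := onFactor_one _
  rw [heisenberg, h, Matrix.mul_one, evol_conjTranspose_mul]

theorem heisenberg_conjTranspose (w : W) (M : Matrix (Fin (C.dim w)) (Fin (C.dim w)) ℂ) :
    (C.heisenberg w M)ᴴ = C.heisenberg w Mᴴ := by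
  have h := onFactor_conjTranspose (x := C.sliceDim (C.birth w)) ⟨w, C.live_birth w⟩ M
  rw [heisenberg, heisenberg, conjTranspose_mul, conjTranspose_mul, conjTranspose_conjTranspose, h,
    Matrix.mul_assoc]

theorem heisenberg_zero (w : W) : C.heisenberg w 0 = 0 := by
  have h : onFactor (C.sliceDim (C.birth w)) ⟨w, C.live_birth w⟩ 0 = 0 := onFactor_zero _
  rw [heisenberg, h, Matrix.mul_zero, Matrix.zero_mul]

theorem heisenberg_add (w : W) (M N : Matrix (Fin (C.dim w)) (Fin (C.dim w)) ℂ) :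
    C.heisenberg w (M + N) = C.heisenberg w M + C.heisenberg w N := by
  have h := onFactor_add (x := C.sliceDim (C.birth w)) ⟨w, C.live_birth w⟩ M N
  rw [heisenberg, heisenberg, heisenberg, h, Matrix.mul_add, Matrix.add_mul]

theorem heisenberg_sum {ι : Type*} (w : W) (S : Finset ι)
    (f : ι → Matrix (Fin (C.dim w)) (Fin (C.dim w)) ℂ) :
    C.heisenberg w (∑ i ∈ S, f i) = ∑ i ∈ S, C.heisenberg w (f i) :=
  map_sum (⟨⟨C.heisenberg w, C.heisenberg_zero w⟩, C.heisenberg_add w⟩ :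
    Matrix (Fin (C.dim w)) (Fin (C.dim w)) ℂ →+ Matrix (C.Basis 0) (C.Basis 0) ℂ) f S

theorem isStarProjection_heisenberg {w : W} {P : Matrix (Fin (C.dim w)) (Fin (C.dim w)) ℂ}
    (hP : IsStarProjection P) : IsStarProjection (C.heisenberg w P) := by
  refine ⟨?_, ?_⟩
  · rw [IsIdempotentElem, ← heisenberg_mul, hP.isIdempotentElem.eq]
  · rw [isSelfAdjoint_iff, star_eq_conjTranspose, heisenberg_conjTranspose, ← star_eq_conjTranspose,
      hP.isSelfAdjoint.star_eq]

section

variable [DecidableEq (Matrix (C.Basis 0) (C.Basis 0) ℂ)] {w : W}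
  (P : ProjectiveDecomposition (Fin (C.dim w)))

theorem isStarProjection_of_mem_image {X : Matrix (C.Basis 0) (C.Basis 0) ℂ}
    (hX : X ∈ P.proj.image (C.heisenberg w)) : IsStarProjection X := by
  obtain ⟨p, hp, rfl⟩ := Finset.mem_image.1 hX
  exact C.isStarProjection_heisenberg (P.isStarProjection p hp)

theorem mul_eq_zero_of_mem_image {X Y : Matrix (C.Basis 0) (C.Basis 0) ℂ}
    (hX : X ∈ P.proj.image (C.heisenberg w)) (hY : Y ∈ P.proj.image (C.heisenberg w))
    (hne : X ≠ Y) : X * Y = 0 := by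
  obtain ⟨p, hp, rfl⟩ := Finset.mem_image.1 hX
  obtain ⟨q, hq, rfl⟩ := Finset.mem_image.1 hY
  rw [← heisenberg_mul, P.orthogonal p hp q hq fun h => hne (by rw [h]), heisenberg_zero]

theorem sum_image_heisenberg : ∑ X ∈ P.proj.image (C.heisenberg w), X = 1 := by
  rw [Finset.sum_image_of_pairwise_eq_zero (g := fun X => X), ← heisenberg_sum, P.sum_eq_one,
    heisenberg_one]
  intro p hp q hq hne heq
  rw [← (C.isStarProjection_heisenberg (P.isStarProjection p hp)).isIdempotentElem.eq]
  nth_rw 2 [heq]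
  rw [← heisenberg_mul, P.orthogonal p hp q hq hne, heisenberg_zero]

end

theorem card_basis_zero : Fintype.card (C.Basis 0) = C.totalDim := by
  simp [totalDim, Fintype.card_pi]

theorem totalDim_ne_zero : C.totalDim ≠ 0 :=
  Finset.prod_ne_zero_iff.2 fun w _ => (C.dim_pos w.1).ne'

open Classical in
variable {C} in
theorem IsPreferredSet.historyCommute {B : Finset W} {D : C.BubbleDecompositions B}
    (hD : C.IsPreferredSet B D) {n : ℕ} (A : Fin n ≃ {w // w ∈ B})
    (hA : ∀ m k : Fin n, m < k → ¬ C.Below (A k) (A m)) :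
    HistoryCommute (interleave (fun k => (D.ingoing (A k)).proj.image (C.heisenberg (A k)))
      (fun k => (D.outgoing (A k)).proj.image (C.heisenberg (A k)))) := by
  have hne : ∀ j k, j < k → A j ≠ A k := fun j k hjk => A.injective.ne hjk.ne
  refine ⟨fun j k hjk P hP Q hQ => ?_, fun j k hjk P hP Q hQ => ?_, fun j k hjk P hP Q hQ => ?_⟩ <;>
    simp only [interleave_zero, interleave_one, Finset.mem_image] at hP hQ <;>
    obtain ⟨p, hp, rfl⟩ := hP <;> obtain ⟨q, hq, rfl⟩ := hQ
  · exact hD.commute_ingoing (hne j k hjk) (hA j k hjk) hq p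
  · exact hD.commute_outgoing (hne j k hjk) (hA j k hjk) hp q
  · exact hD.commute_ingoing (hne j k hjk) (hA j k hjk) hq p

end UnitaryCircuit

open Classical in
theorem theorem3 {W : Type*} [Fintype W] [DecidableEq W] (C : UnitaryCircuit W) (B : Finset W)
    (n : ℕ) (A : Fin n ≃ {w // w ∈ B}) (hA : ∀ m k : Fin n, m < k → ¬ C.Below (A k) (A m)) :
    (∃! D : C.BubbleDecompositions B, C.IsPreferredSet B D) ∧
    ∀ D : C.BubbleDecompositions B, C.IsPreferredSet B D →
      (∀ (P P' : ∀ k : Fin n, Matrix (Fin (C.dim (A k))) (Fin (C.dim (A k))) ℂ),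
        (∀ k, P k ∈ (D.ingoing (A k)).proj) → (∀ k, P' k ∈ (D.outgoing (A k)).proj) →
        historyProb ((C.totalDim : ℂ)⁻¹ • 1)
            (interleave (fun k => C.heisenberg (A k) (P k)) (fun k => C.heisenberg (A k) (P' k))) =
          (C.totalDim : ℂ)⁻¹ *
            Matrix.trace (List.ofFn (interleave (fun k => C.heisenberg (A k) (P k))
              (fun k => C.heisenberg (A k) (P' k)))).prod) ∧
      IsConsistent ((C.totalDim : ℂ)⁻¹ • (1 : Matrix (C.Basis 0) (C.Basis 0) ℂ))
        (interleave (fun k => (D.ingoing (A k)).proj.image (C.heisenberg (A k)))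
          (fun k => (D.outgoing (A k)).proj.image (C.heisenberg (A k)))) := by
  refine ⟨UnitaryCircuit.existsUnique_isPreferredSet, fun D hD => ⟨fun P P' hP hP' => ?_, ?_⟩⟩
  · refine historyProb_eq_trace _ ?_ (hD.historyCommute A hA) ?_ <;> rw [forall_fin_mul_two] <;>
      intro k <;> simp only [interleave_zero, interleave_one]
    · exact ⟨C.isStarProjection_heisenberg ((D.ingoing _).isStarProjection _ (hP k)),
        C.isStarProjection_heisenberg ((D.outgoing _).isStarProjection _ (hP' k))⟩
    · exact ⟨Finset.mem_image_of_mem _ (hP k), Finset.mem_image_of_mem _ (hP' k)⟩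
  · refine (hD.historyCommute A hA).isConsistent C.card_basis_zero C.totalDim_ne_zero ?_ ?_ ?_ <;>
      rw [forall_fin_mul_two] <;> intro k <;> simp only [interleave_zero, interleave_one]
    · exact ⟨fun _ => C.isStarProjection_of_mem_image _, fun _ => C.isStarProjection_of_mem_image _⟩
    · exact ⟨fun _ hX _ hY => C.mul_eq_zero_of_mem_image _ hX hY,
        fun _ hX _ hY => C.mul_eq_zero_of_mem_image _ hX hY⟩
    · exact ⟨C.sum_image_heisenberg _, C.sum_image_heisenberg _⟩
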